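/- Setting. For each sign $\nu\in\{+,-\}$ let $m^\nu\ge 1$ be an integer, $\alpha_0^\nu,\beta_0^\nu,\alpha_i^\nu,\beta_i^\nu\in\mathbb R$ and $\eta_i^\nu\in[-1,1]\setminus\{\nu 1\}$ ($1\le i\le m^\nu$), with $$\alpha_0^\nu\ge 0,\qquad \alpha_0^\nu+|\beta_0^\nu|>0,\qquad \nu\beta_0^\nu\ge 0,\qquad \Big(\frac{\sum_i|\alpha_i^\nu|}{\alpha_0^\nu}\Big)^2+\Big(\frac{\sum_i|\beta_i^\nu|}{\beta_0^\nu}\Big)^2<1,$$ where, if a denominator is zero, the corresponding numerator is required to be zero and the fraction is omitted. Consider the eigenvalue problem, with $\lambda\in\mathbb R$ and $u\in C^2[-1,1]$, $$-u''=\lambda u \ \text{ on } (-1,1),\qquad \alpha_0^\pm u(\pm1)+\beta_0^\pm u'(\pm1)=\sum_{i=1}^{m^\pm}\alpha_i^\pm u(\eta_i^\pm)+\sum_{i=1}^{m^\pm}\beta_i^\pm u'(\eta_i^\pm),$$ and suppose that $\alpha_i^-=\beta_i^-=0$ for all $i$, so that the condition at $-1$ is the single-point condition $(R)$: $\alpha_0^-u(-1)+\beta_0^-u'(-1)=0$.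 Nodal sets. $S_k$ is the set of $u\in C^2[-1,1]$ with $u(\pm1)\ne0$ such that $u$ has only simple zeros in $(-1,1)$, exactly $k$ of them. $T_k$ is the set of $u\in C^2[-1,1]$ with $u'(\pm1)\neq0$ such that $u'$ has only simple zeros in $(-1,1)$, exactly $k$ of them, and $u$ has a zero strictly between any two consecutive zeros of $u'$. If $\beta_0^-=0$, then in the definition of $S_k$ the requirement $u(-1)\ne0$ is replaced by $(R)$, that is $u(-1)=0$, together with $u'(-1)\neq0$; the zero at $-1$ is not counted. If $\alpha_0^-=0$, then in the definition of $T_k$ the requirement $u'(-1)\ne 0$ is replaced by $(R)$, that is $u'(-1)=0$, and the zeros of $u'$ in $(-1,1)$ are replaced by those in $[-1,1)$; so $-1$ is a simple zero of $u'$ and is counted. Theorem. The eigenvalues of this problem form a strictly increasing sequence $\lambda_0<\lambda_1<\cdots$; likewise the eigenvalues of $-u''=\lambda u$ with $(R)$ and $u'(1)=0$ form a strictly increasing sequence $(\lambda_k^{RN})_{k\ge0}$, and those with $(R)$ and $u(1)=0$ a strictly increasing sequence $(\lambda_k^{RD})_{k\ge0}$. Let $\psi_k$ denote any eigenfunction for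 $\lambda_k$. Then, for every integer $k_0\ge0$: (a) If $\alpha_0^+>\sum_i|\alpha_i^+|+\lambda^{1/2}\sum_i|\beta_i^+|$ for $\lambda=\lambda_{k_0}^{RN}$, then for all $0\le k\le k_0-1$: $\psi_k\in T_{k+1}$ and $\lambda_k^{RN}<\lambda_k<\lambda_{k+1}^{RN}$. (b) If $\beta_0^+>\lambda^{-1/2}\sum_i|\alpha_i^+|+\sum_i|\beta_i^+|$ for $\lambda=\lambda_{k_0}^{RD}$, then for all $k\ge k_0+1$: $\psi_k\in S_k$ and $\lambda_{k-1}^{RD}<\lambda_k<\lambda_k^{RD}$. If the inequality in (b) holds for $\lambda=\lambda_0^{RD}$, then moreover $\psi_k\in S_k$ for all $k\ge0$ and $0\le\lambda_0<\lambda_0^{RD}$, with $0<\lambda_0$ if $\alpha_0^-+\alpha_0^+>0$. -/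

import Mathlib

open Set

namespace MultiPoint

/-- The closed interval `[-1,1]`. -/
abbrev I : Set ℝ := Icc (-1) 1

/-- The (one-sided at the end points) derivative on `[-1,1]`. -/
noncomputable def D (u : ℝ → ℝ) (x : ℝ) : ℝ := derivWithin u I x

/-- The coefficients of one multi-point boundary condition at an end point `e`:
`a0 * u e + b0 * u' e = ∑ i, a i * u (η i) + ∑ i, b i * u' (η i)`. -/
structure BoundaryData where
  m : ℕ
  a0 : ℝ
  b0 : ℝ
  a : Fin m → ℝ
  b : Fin m → ℝ
  η : Fin m → ℝ

namespace BoundaryData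

/-- Standing assumptions on a boundary condition at the end point `e` (`e = 1` or `e = -1`).
The last three clauses express `(∑|a i| / a0)² + (∑|b i| / b0)² < 1` with the convention that a zero
denominator forces a zero numerator and that the corresponding fraction is then omitted
(in Lean `x / 0 = 0`). -/
structure Admissible (B : BoundaryData) (e : ℝ) : Prop where
  one_le_m : 1 ≤ B.m
  η_mem : ∀ i, B.η i ∈ I
  η_ne : ∀ i, B.η i ≠ e
  a0_nonneg : 0 ≤ B.a0
  nontrivial : 0 < B.a0 + |B.b0|
  b0_sign : 0 ≤ e * B.b0
  a_zero : B.a0 = 0 → ∑ i, |B.a i| = 0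
  b_zero : B.b0 = 0 → ∑ i, |B.b i| = 0
  sum_lt_one : ((∑ i, |B.a i|) / B.a0) ^ 2 + ((∑ i, |B.b i|) / B.b0) ^ 2 < 1

/-- `u` satisfies the multi-point condition `B` at the end point `e`. -/
def Holds (B : BoundaryData) (e : ℝ) (u : ℝ → ℝ) : Prop :=
  B.a0 * u e + B.b0 * D u e = ∑ i, B.a i * u (B.η i) + ∑ i, B.b i * D u (B.η i)

/-- `u` satisfies the single-point (Robin) condition `a0 * u e + b0 * u' e = 0`. -/
def Robin (B : BoundaryData) (e : ℝ) (u : ℝ → ℝ) : Prop :=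
  B.a0 * u e + B.b0 * D u e = 0

/-- The derivative-nonvanishing inequality at `lam`. -/
def DerivCond (B : BoundaryData) (lam : ℝ) : Prop :=
  ∑ i, |B.a i| + √lam * ∑ i, |B.b i| < B.a0

/-- The value-nonvanishing inequality at `lam`. -/
def ValueCond (B : BoundaryData) (lam : ℝ) : Prop :=
  1 / √lam * ∑ i, |B.a i| + ∑ i, |B.b i| < B.b0

end BoundaryData

/-- `u ∈ C²[-1,1]` is a nontrivial solution of `-u'' = lam * u` on `(-1,1)` that satisfies the
boundary conditions `bcl` (at `-1`) and `bcr` (at `1`). -/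
structure IsEigenfunction (bcl bcr : (ℝ → ℝ) → Prop) (lam : ℝ) (u : ℝ → ℝ) : Prop where
  contDiffOn : ContDiffOn ℝ 2 u I
  ode : ∀ x ∈ Ioo (-1 : ℝ) 1, -D (D u) x = lam * u x
  left : bcl u
  right : bcr u
  nontrivial : ∃ x ∈ I, u x ≠ 0

/-- The set of eigenvalues. -/
def spec (bcl bcr : (ℝ → ℝ) → Prop) : Set ℝ :=
  {lam | ∃ u, IsEigenfunction bcl bcr lam u}

/-- `lam 0 < lam 1 < ⋯` is the list of all eigenvalues in increasing order. -/
def IsEigenvalueSequence (bcl bcr : (ℝ → ℝ) → Prop) (lam : ℕ → ℝ) : Prop :=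
  StrictMono lam ∧ range lam = spec bcl bcr

/-- The increasing list of all eigenvalues is unique if it exists. -/
theorem IsEigenvalueSequence.unique {bcl bcr : (ℝ → ℝ) → Prop} {lam mu : ℕ → ℝ}
    (h : IsEigenvalueSequence bcl bcr lam) (h' : IsEigenvalueSequence bcl bcr mu) : lam = mu :=
  (StrictMono.range_inj h.1 h'.1).1 (h.2.trans h'.2.symm)

/-- The Dirichlet condition `u(1) = 0`. -/
def Dirichlet1 (u : ℝ → ℝ) : Prop := u 1 = 0

/-- The Neumann condition `u'(1) = 0`. -/
def Neumann1 (u : ℝ → ℝ) : Prop := D u 1 = 0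

/-- All zeros of `f` in `J` are simple, and there are exactly `k` of them. -/
def SimpleZeros (f : ℝ → ℝ) (J : Set ℝ) (k : ℕ) : Prop :=
  (∀ x ∈ J, f x = 0 → D f x ≠ 0) ∧ {x ∈ J | f x = 0}.encard = k

/-- `u` has a zero strictly between any two consecutive zeros of `u'` in `J`. -/
def ZeroBetween (u : ℝ → ℝ) (J : Set ℝ) : Prop :=
  ∀ x ∈ J, ∀ y ∈ J, x < y → D u x = 0 → D u y = 0 → (∀ z ∈ Ioo x y, D u z ≠ 0) →
    ∃ z ∈ Ioo x y, u z = 0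

/-- The set `S_k^+`. -/
def SPlus (k : ℕ) : Set (ℝ → ℝ) :=
  {u | ContDiffOn ℝ 2 u I ∧ u (-1) ≠ 0 ∧ u 1 ≠ 0 ∧ 0 < u (-1) ∧
    SimpleZeros u (Ioo (-1) 1) k}

/-- `S_k = S_k^+ ∪ (-S_k^+)`. -/
def S (k : ℕ) : Set (ℝ → ℝ) := SPlus k ∪ {u | (fun x => -u x) ∈ SPlus k}

/-- The set `T_k^+`. -/
def TPlus (k : ℕ) : Set (ℝ → ℝ) :=
  {u | ContDiffOn ℝ 2 u I ∧ D u (-1) ≠ 0 ∧ D u 1 ≠ 0 ∧ 0 < D u (-1) ∧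
    SimpleZeros (D u) (Ioo (-1) 1) k ∧ ZeroBetween u (Ioo (-1) 1)}

/-- `T_k = T_k^+ ∪ (-T_k^+)`. -/
def T (k : ℕ) : Set (ℝ → ℝ) := TPlus k ∪ {u | (fun x => -u x) ∈ TPlus k}

/-- `S_k` as used with the single-point condition `B` at `-1`. If that is the Dirichlet condition
(`b0 = 0`), the requirement `u(-1) ≠ 0` is replaced by the boundary condition, with `-1` a simple
zero of `u` that is not counted. -/
def SRobin (B : BoundaryData) (k : ℕ) : Set (ℝ → ℝ) :=
  {u | (B.b0 ≠ 0 ∧ u ∈ S k) ∨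
    (B.b0 = 0 ∧ ContDiffOn ℝ 2 u I ∧ B.Robin (-1) u ∧ D u (-1) ≠ 0 ∧ u 1 ≠ 0 ∧
      SimpleZeros u (Ioo (-1) 1) k)}

/-- `T_k` as used with the single-point condition `B` at `-1`. If that is the Neumann condition
(`a0 = 0`), the requirement `u'(-1) ≠ 0` is replaced by the boundary condition, with `-1` a simple
zero of `u'` that is counted among the zeros of `u'`. -/
def TRobin (B : BoundaryData) (k : ℕ) : Set (ℝ → ℝ) :=
  {u | (B.a0 ≠ 0 ∧ u ∈ T k) ∨
    (B.a0 = 0 ∧ ContDiffOn ℝ 2 u I ∧ B.Robin (-1) u ∧ D u 1 ≠ 0 ∧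
      SimpleZeros (D u) (Ico (-1) 1) k ∧ ZeroBetween u (Ico (-1) 1))}

end MultiPoint

namespace MultiPoint

open Real Filter Topology

/-! ### Functions increasing through their zeros -/

/-! Put `c = α₀⁻ ≥ 0`, `d = -β₀⁻ ≥ 0`. For `λ = s² > 0` the condition at `-1` leaves, up to a
factor, only `sin θ(x)` with the Prüfer-type phase `θ(x) = s (x + 1) + ang c d s`. Inserting it in
the condition at `1` gives `charFn`, here `F(s)`, whose positive zeros are the square roots of the
positive eigenvalues.

The single-point side of `F` is `ρ sin W`, with `ρ² = α₀² + (s β₀)²` and `W = totalPhase` strictly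
increasing in `s`. By Cauchy-Schwarz, admissibility makes the multi-point side smaller than `ρ`
(`lt_amplitude`), so `F` has the sign `(-1)^j` where `W = π/2 + jπ`. The core is
`charDeriv_mul_cos_pos`: at a zero of `F`, `F'` has the sign of `cos W`. Hence each window `π/2 + kπ
< W < π/2 + (k+1)π` holds exactly one zero `r k` (`exists_root`), and there are no others
(`exists_eq_root`). Nonpositive eigenvalues are excluded by monotonicity, except `0` when `α₀⁻ = α₀⁺
= 0`; that one takes the place of the zero in the first window.

The Neumann and Dirichlet comparison problems are instances of the same construction, with `θ(1) =
π/2 + kπ` and `θ(1) = (k+1)π` at their roots. Since `0 ≤ W - θ(1) ≤ π/2`, one half of each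
interlacing is automatic. The inequalities in (a) and (b) fix the sign of `F` at the comparison
roots, which gives the other half. The resulting bounds on `θ(1)` count the zeros of `sin θ` and
`cos θ`. -/

theorem pos_of_deriv_pos_at_zeros {f f' : ℝ → ℝ} {a b : ℝ}
    (hf : ∀ x ∈ Icc a b, HasDerivAt f (f' x) x) (ha : 0 ≤ f a)
    (h : ∀ x ∈ Icc a b, f x = 0 → 0 < f' x) : ∀ x ∈ Ioc a b, 0 < f x := by
  -- A comparison with the constant `0` gives only the weak inequality; a later zero is then
  -- impossible, since its positive derivative would make `f` negative just to the left.
  have hnn : ∀ x ∈ Icc a b, 0 ≤ f x := by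
    intro x hx
    exact image_le_of_deriv_right_lt_deriv_boundary' (f := fun _ => (0 : ℝ)) (f' := fun _ => 0)
      continuousOn_const (fun x _ => hasDerivWithinAt_const _ _ _) (B := f) (B' := f') ha
      (fun x hx => (hf x hx).continuousAt.continuousWithinAt)
      (fun x hx => (hf x ⟨hx.1, hx.2.le⟩).hasDerivWithinAt)
      (fun x hx h0 => h x ⟨hx.1, hx.2.le⟩ h0.symm) hx
  intro x hx
  have hxI : x ∈ Icc a b := ⟨hx.1.le, hx.2⟩
  rcases (hnn x hxI).lt_or_eq with h1 | h1
  · exact h1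
  exfalso
  have hd := h x hxI h1.symm
  have hs := (hasDerivAt_iff_tendsto_slope.1 (hf x hxI)).eventually (eventually_gt_nhds hd)
  have hs' : ∀ᶠ y in 𝓝[<] x, 0 < slope f x y :=
    hs.filter_mono (nhdsWithin_mono _ fun y hy => ne_of_lt hy)
  have hlt : ∀ᶠ y in 𝓝[<] x, y ∈ Ioo a x := Ioo_mem_nhdsLT hx.1
  obtain ⟨y, hy1, hy2⟩ := (hs'.and hlt).exists
  rw [slope_def_field, ← h1, sub_zero] at hy1
  have := hnn y ⟨hy2.1.le, hy2.2.le.trans hx.2⟩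
  exact absurd hy1 (not_lt.2 (div_nonpos_of_nonneg_of_nonpos this (sub_nonpos.2 hy2.2.le)))

/-! ### The phase of a vector `(c, s * d)` in the closed first quadrant -/

/-- The argument of the vector `(c, s * d)`. -/
noncomputable def ang (c d s : ℝ) : ℝ := if c = 0 then π / 2 else arctan (s * (d / c))

/-- The derivative of `ang c d`. -/
noncomputable def angDeriv (c d s : ℝ) : ℝ :=
  if c = 0 then 0 else 1 / (1 + (s * (d / c)) ^ 2) * (d / c)

section ang
variable {c d s : ℝ}

/-- For `c = 0` the angle is constant in `s`, so it is differentiable even at `s = 0`, where the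
vector itself vanishes. -/
theorem hasDerivAt_ang : HasDerivAt (ang c d) (angDeriv c d s) s := by
  unfold ang angDeriv
  split_ifs with h
  · simpa using hasDerivAt_const s (π / 2)
  · simpa using ((hasDerivAt_id s).mul_const (d / c)).arctan

theorem angDeriv_nonneg (hc : 0 ≤ c) (hd : 0 ≤ d) : 0 ≤ angDeriv c d s := by
  unfold angDeriv
  split_ifs <;> positivity

theorem monotone_ang (hc : 0 ≤ c) (hd : 0 ≤ d) : Monotone (ang c d) :=
  monotone_of_hasDerivAt_nonneg (fun _ => hasDerivAt_ang) fun _ => angDeriv_nonneg hc hd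

theorem ang_nonneg (hc : 0 ≤ c) (hd : 0 ≤ d) (hs : 0 ≤ s) : 0 ≤ ang c d s := by
  unfold ang
  split_ifs
  · positivity
  · exact arctan_nonneg.2 (mul_nonneg hs (div_nonneg hd hc))

theorem ang_le (c d s : ℝ) : ang c d s ≤ π / 2 := by
  unfold ang
  split_ifs
  · exact le_rfl
  · exact (arctan_lt_pi_div_two _).le

theorem ang_lt (h : c ≠ 0) : ang c d s < π / 2 := by
  rw [ang, if_neg h]
  exact arctan_lt_pi_div_two _

theorem ang_of_zero (d s : ℝ) : ang 0 d s = π / 2 := by simp [ang]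

theorem ang_zero (h : c ≠ 0) : ang c d 0 = 0 := by simp [ang, h]

theorem ang_pos (hc : 0 ≤ c) (hd : 0 < d) (hs : 0 < s) : 0 < ang c d s := by
  unfold ang
  split_ifs with h
  · positivity
  · have : 0 < c := lt_of_le_of_ne hc (Ne.symm h)
    exact arctan_pos.2 (by positivity)

theorem ang_of_right_zero (h : c ≠ 0) : ang c 0 s = 0 := by simp [ang, h]

theorem cos_ang (hc : 0 ≤ c) :
    √(c ^ 2 + (s * d) ^ 2) * cos (ang c d s) = c := by
  unfold ang
  split_ifs with h
  · simp [h]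
  · have hc' : 0 < c := lt_of_le_of_ne hc (Ne.symm h)
    have : √(c ^ 2 + (s * d) ^ 2) = c * √(1 + (s * (d / c)) ^ 2) := by
      rw [← sqrt_sq hc, ← sqrt_mul (by positivity), sqrt_sq hc]
      congr 1
      field_simp
    rw [this, cos_arctan]
    have : √(1 + (s * (d / c)) ^ 2) ≠ 0 := by positivity
    field_simp

theorem sin_ang (hc : 0 ≤ c) (hd : 0 ≤ d) (hs : 0 ≤ s) :
    √(c ^ 2 + (s * d) ^ 2) * sin (ang c d s) = s * d := by
  by_cases h : c = 0
  · subst h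
    rw [ang_of_zero, sin_pi_div_two, mul_one]
    simpa using sqrt_sq (mul_nonneg hs hd)
  · have h2 := cos_ang (d := d) (s := s) hc
    have ht : tan (ang c d s) = s * (d / c) := by rw [ang, if_neg h, tan_arctan]
    have hcos : cos (ang c d s) ≠ 0 := fun h0 => by rw [h0, mul_zero] at h2; exact h h2.symm
    rw [tan_eq_sin_div_cos, div_eq_iff hcos] at ht
    rw [ht, ← mul_assoc, mul_comm _ (s * (d / c)), mul_assoc, h2]
    field_simp

end ang

/-! ### Consequences of admissibility at `1` -/

namespace BoundaryData

/-- The sum of the absolute values of the value coefficients. -/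
noncomputable def sumA (B : BoundaryData) : ℝ := ∑ i, |B.a i|

/-- The sum of the absolute values of the derivative coefficients. -/
noncomputable def sumB (B : BoundaryData) : ℝ := ∑ i, |B.b i|

theorem sumA_nonneg (B : BoundaryData) : 0 ≤ B.sumA := Finset.sum_nonneg fun _ _ => abs_nonneg _

theorem sumB_nonneg (B : BoundaryData) : 0 ≤ B.sumB := Finset.sum_nonneg fun _ _ => abs_nonneg _

namespace Admissible
variable {B : BoundaryData}

theorem b0_nonneg (hB : B.Admissible 1) : 0 ≤ B.b0 := by simpa using hB.b0_sign

theorem add_pos (hB : B.Admissible 1) : 0 < B.a0 + B.b0 := by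
  simpa [abs_of_nonneg hB.b0_nonneg] using hB.nontrivial

theorem exists_ratio (hB : B.Admissible 1) : ∃ p q : ℝ, 0 ≤ p ∧ 0 ≤ q ∧ p ^ 2 + q ^ 2 < 1 ∧
    B.sumA = p * B.a0 ∧ B.sumB = q * B.b0 := by
  refine ⟨B.sumA / B.a0, B.sumB / B.b0, div_nonneg B.sumA_nonneg hB.a0_nonneg,
    div_nonneg B.sumB_nonneg hB.b0_nonneg, hB.sum_lt_one, ?_, ?_⟩
  · by_cases h : B.a0 = 0
    · rw [h, mul_zero]; exact hB.a_zero h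
    · field_simp
  · by_cases h : B.b0 = 0
    · rw [h, mul_zero]; exact hB.b_zero h
    · field_simp

theorem sumA_le (hB : B.Admissible 1) : B.sumA ≤ B.a0 := by
  obtain ⟨p, q, hp, hq, hpq, h1, h2⟩ := hB.exists_ratio
  rw [h1]
  exact mul_le_of_le_one_left hB.a0_nonneg (by nlinarith)

theorem sumB_le (hB : B.Admissible 1) : B.sumB ≤ B.b0 := by
  obtain ⟨p, q, hp, hq, hpq, h1, h2⟩ := hB.exists_ratio
  rw [h2]
  exact mul_le_of_le_one_left hB.b0_nonneg (by nlinarith)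

theorem sumA_lt (hB : B.Admissible 1) (h : 0 < B.a0) : B.sumA < B.a0 := by
  obtain ⟨p, q, hp, hq, hpq, h1, h2⟩ := hB.exists_ratio
  rw [h1]
  exact mul_lt_of_lt_one_left h (by nlinarith)

theorem sumB_lt (hB : B.Admissible 1) (h : 0 < B.b0) : B.sumB < B.b0 := by
  obtain ⟨p, q, hp, hq, hpq, h1, h2⟩ := hB.exists_ratio
  rw [h2]
  exact mul_lt_of_lt_one_left h (by nlinarith)

theorem b0_pos (hB : B.Admissible 1) (h : B.a0 = 0) : 0 < B.b0 := by
  simpa [h] using hB.add_pos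

theorem a_eq_zero (hB : B.Admissible 1) (h : B.a0 = 0) (i) : B.a i = 0 := by
  have := (Finset.sum_eq_zero_iff_of_nonneg fun i _ => abs_nonneg (B.a i)).1 (hB.a_zero h)
  simpa using this i (Finset.mem_univ i)

/-- The right-hand side of the boundary condition is smaller than the amplitude of the left. -/
theorem lt_amplitude (hB : B.Admissible 1) {s : ℝ} (hs : 0 < s) :
    B.sumA + s * B.sumB < √(B.a0 ^ 2 + (s * B.b0) ^ 2) := by
  obtain ⟨p, q, hp, hq, hpq, h1, h2⟩ := hB.exists_ratio
  have h0 : 0 < B.a0 ^ 2 + (s * B.b0) ^ 2 := by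
    rcases hB.a0_nonneg.lt_or_eq with h | h
    · positivity
    · have := hB.b0_pos h.symm
      positivity
  apply lt_sqrt_of_sq_lt
  rw [h1, h2]
  -- Lagrange's identity: the square is the defect in Cauchy-Schwarz for `(p, q)` and `(a0, s *
  -- b0)`.
  nlinarith [sq_nonneg (p * (s * B.b0) - q * B.a0)]

end Admissible
end BoundaryData

/-! ### The characteristic function -/

/-- The phase at `x` of the solution with frequency `s`. -/
noncomputable def phase (c d s x : ℝ) : ℝ := s * (x + 1) + ang c d s

/-- The positive zeros `s` of this function are the square roots of the positive eigenvalues. -/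
noncomputable def charFn (c d : ℝ) (B : BoundaryData) (s : ℝ) : ℝ :=
  B.a0 * sin (phase c d s 1) + B.b0 * (s * cos (phase c d s 1)) -
    (∑ i, B.a i * sin (phase c d s (B.η i)) + ∑ i, B.b i * (s * cos (phase c d s (B.η i))))

/-- The derivative of the phase with respect to the frequency. -/
noncomputable def phaseDeriv (c d s x : ℝ) : ℝ := (x + 1) + angDeriv c d s

/-- The derivative of `charFn`. -/
noncomputable def charDeriv (c d : ℝ) (B : BoundaryData) (s : ℝ) : ℝ :=
  B.a0 * (cos (phase c d s 1) * phaseDeriv c d s 1) +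
    B.b0 * (cos (phase c d s 1) + s * (-sin (phase c d s 1) * phaseDeriv c d s 1)) -
    (∑ i, B.a i * (cos (phase c d s (B.η i)) * phaseDeriv c d s (B.η i)) +
      ∑ i, B.b i * (cos (phase c d s (B.η i)) +
        s * (-sin (phase c d s (B.η i)) * phaseDeriv c d s (B.η i))))

/-- The combined phase of the left-hand side of the boundary condition at `1`. -/
noncomputable def totalPhase (c d : ℝ) (B : BoundaryData) (s : ℝ) : ℝ :=
  phase c d s 1 + ang B.a0 B.b0 s

section char
variable {c d s : ℝ} {B : BoundaryData}

theorem hasDerivAt_phase (x : ℝ) :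
    HasDerivAt (fun s => phase c d s x) (phaseDeriv c d s x) s := by
  unfold phase phaseDeriv
  exact (hasDerivAt_mul_const (x + 1)).fun_add hasDerivAt_ang

theorem hasDerivAt_sin_phase (x : ℝ) :
    HasDerivAt (fun s => sin (phase c d s x)) (cos (phase c d s x) * phaseDeriv c d s x) s :=
  (hasDerivAt_phase x).sin

theorem hasDerivAt_cos_phase (x : ℝ) :
    HasDerivAt (fun s => s * cos (phase c d s x))
      (cos (phase c d s x) + s * (-sin (phase c d s x) * phaseDeriv c d s x)) s := by
  simpa using (hasDerivAt_id s).fun_mul (hasDerivAt_phase (c := c) (d := d) (s := s) x).cos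

theorem hasDerivAt_charFn : HasDerivAt (charFn c d B) (charDeriv c d B s) s := by
  unfold charFn charDeriv
  refine (((hasDerivAt_sin_phase 1).const_mul _).add ((hasDerivAt_cos_phase 1).const_mul _)).sub
    (HasDerivAt.add ?_ ?_)
  · exact HasDerivAt.fun_sum fun i _ => (hasDerivAt_sin_phase (B.η i)).const_mul _
  · exact HasDerivAt.fun_sum fun i _ => (hasDerivAt_cos_phase (B.η i)).const_mul _

/-- Addition theorem, with `(a0, s * b0)` in polar coordinates. -/
theorem charFn_amplitude (hB : B.Admissible 1) (hs : 0 ≤ s) :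
    B.a0 * sin (phase c d s 1) + B.b0 * (s * cos (phase c d s 1)) =
      √(B.a0 ^ 2 + (s * B.b0) ^ 2) * sin (totalPhase c d B s) := by
  rw [totalPhase, sin_add]
  have h1 := cos_ang (d := B.b0) (s := s) hB.a0_nonneg
  have h2 := sin_ang hB.a0_nonneg hB.b0_nonneg hs
  linear_combination (-sin (phase c d s 1)) * h1 - cos (phase c d s 1) * h2

theorem charDeriv_amplitude (hB : B.Admissible 1) (hs : 0 ≤ s) :
    B.a0 * cos (phase c d s 1) - B.b0 * (s * sin (phase c d s 1)) =
      √(B.a0 ^ 2 + (s * B.b0) ^ 2) * cos (totalPhase c d B s) := by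
  rw [totalPhase, cos_add]
  have h1 := cos_ang (d := B.b0) (s := s) hB.a0_nonneg
  have h2 := sin_ang hB.a0_nonneg hB.b0_nonneg hs
  linear_combination (-cos (phase c d s 1)) * h1 + sin (phase c d s 1) * h2

theorem abs_sum_sin_le (t : Fin B.m → ℝ) : |∑ i, B.a i * sin (t i)| ≤ B.sumA := by
  refine (Finset.abs_sum_le_sum_abs _ _).trans (Finset.sum_le_sum fun i _ => ?_)
  rw [abs_mul]
  exact mul_le_of_le_one_right (abs_nonneg _) (abs_sin_le_one _)

theorem abs_sum_cos_le (hs : 0 ≤ s) (t : Fin B.m → ℝ) :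
    |∑ i, B.b i * (s * cos (t i))| ≤ s * B.sumB := by
  rw [BoundaryData.sumB, Finset.mul_sum]
  refine (Finset.abs_sum_le_sum_abs _ _).trans (Finset.sum_le_sum fun i _ => ?_)
  rw [abs_mul, abs_mul, abs_of_nonneg hs, mul_left_comm]
  exact mul_le_mul_of_nonneg_left
    (mul_le_of_le_one_right (abs_nonneg _) (abs_cos_le_one _)) hs

/-! ### Direction of crossing at a zero of the characteristic function -/

theorem phaseDeriv_nonneg (hc : 0 ≤ c) (hd : 0 ≤ d) {x : ℝ} (hx : x ∈ I) :
    0 ≤ phaseDeriv c d s x :=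
  add_nonneg (by linarith [hx.1]) (angDeriv_nonneg hc hd)

/-- As `s` grows, the phase moves fastest at the end point `1`; therefore the interior terms cannot
outrun the boundary term. -/
theorem phaseDeriv_le {x : ℝ} (hx : x ∈ I) : phaseDeriv c d s x ≤ phaseDeriv c d s 1 := by
  unfold phaseDeriv
  linarith [hx.2]

theorem phaseDeriv_one_pos (hc : 0 ≤ c) (hd : 0 ≤ d) : 0 < phaseDeriv c d s 1 := by
  unfold phaseDeriv
  linarith [angDeriv_nonneg (s := s) hc hd]

/-- The planar Cauchy-Schwarz inequality for a contracted unit vector. -/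
theorem mul_cos_add_mul_sin_le {r t w y : ℝ} (hr : 0 ≤ r) (hrt : r ≤ t) :
    |cos w * (cos y * r) + sin w * (t * sin y)| ≤ t := by
  have ht : 0 ≤ t := hr.trans hrt
  apply abs_le_of_sq_le_sq _ ht
  have h1 := sin_sq_add_cos_sq w
  have h2 := sin_sq_add_cos_sq y
  have h3 : (cos y * r) ^ 2 + (t * sin y) ^ 2 ≤ t ^ 2 := by
    have : t ^ 2 = t ^ 2 * cos y ^ 2 + (t * sin y) ^ 2 := by linear_combination (-t ^ 2) * h2
    have h4 : r ^ 2 ≤ t ^ 2 := pow_le_pow_left₀ hr hrt 2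
    nlinarith [sq_nonneg (cos y)]
  calc _ ≤ (sin w ^ 2 + cos w ^ 2) * ((cos y * r) ^ 2 + (t * sin y) ^ 2) := by
        nlinarith [sq_nonneg (cos w * (t * sin y) - sin w * (cos y * r))]
    _ ≤ t ^ 2 := by rw [h1, one_mul]; exact h3

/-- This controls the part of `charDeriv` that comes from the explicit factor `s` in `s * cos`;
there `(S, C) = (sin θ, cos θ)` and `b = s * b0`. If the conclusion failed, combining `h` with `hG`
would give `1 < ±(p S + q C)`, impossible for a unit vector `(S, C)` and `p² + q² < 1`. -/
theorem remainder_nonneg_aux {a b p q X Y S C : ℝ} (ha : 0 ≤ a) (hb : 0 ≤ b) (hp : 0 ≤ p)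
    (hpq : p ^ 2 + q ^ 2 < 1) (hX : |X| ≤ p * a) (hY : |Y| ≤ q * b)
    (hSC : S ^ 2 + C ^ 2 = 1) (h : a * S + b * C = X + Y) (hG : 0 < a * C - b * S) :
    0 ≤ b * C - Y := by
  by_contra! hneg
  obtain ⟨hX1, hX2⟩ := abs_le.1 hX
  obtain ⟨hY1, hY2⟩ := abs_le.1 hY
  have hb' : 0 < b := lt_of_le_of_ne hb (by rintro rfl; simp at hneg hY; simp [hY] at hneg)
  have hXS : X < a * S := by linarith
  have ha' : 0 < a := lt_of_le_of_ne ha (by rintro rfl; simp at hX hXS; simp [hX] at hXS)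
  have hCq : C < q := by nlinarith
  have hSp : -p < S := by nlinarith
  have hcs : p * S + q * C < 1 := by nlinarith [sq_nonneg (p - S), sq_nonneg (q - C)]
  have hcs' : -(p * S + q * C) < 1 := by nlinarith [sq_nonneg (p + S), sq_nonneg (q + C)]
  -- For `S ≥ 0`, `hG` gives `C > 0`, and `C < q` then forces `S > p` because `S² + C² = 1 > p² +
  -- q²`. For `S < 0`, `S > -p` forces `C < -q` in the same way.
  rcases le_or_gt 0 S with hS | hS
  · have hC : 0 < C := by nlinarith [mul_nonneg hb hS]
    have hpS : p < S := by nlinarith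
    have h1 : a * (S - p) ≤ b * (q - C) := by linarith
    have h2 : b * S * (S - p) < a * C * (S - p) :=
      mul_lt_mul_of_pos_right (by linarith) (by linarith)
    have h3 : a * (S - p) * C ≤ b * (q - C) * C := mul_le_mul_of_nonneg_right h1 hC.le
    have h4 : b * (S * (S - p)) < b * ((q - C) * C) := by linarith
    have := lt_of_mul_lt_mul_left h4 hb
    nlinarith
  · have hC : C < -q := by nlinarith
    have h1 : b * (-C - q) ≤ a * (p + S) := by linarith
    have h2 : a * (-C) * (-C - q) < b * (-S) * (-C - q) :=
      mul_lt_mul_of_pos_right (by linarith) (by linarith)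
    have h3 : b * (-C - q) * (-S) ≤ a * (p + S) * (-S) :=
      mul_le_mul_of_nonneg_right h1 (by linarith)
    have h4 : a * (-C * (-C - q)) < a * ((p + S) * (-S)) := by linarith
    have := lt_of_mul_lt_mul_left h4 ha
    nlinarith

/-- The derivative splits as `τ ρ cos w - (X' + Y')` plus a remainder from differentiating the
factor `s`. After multiplication by `cos w` the first part is positive (`hmain`) and the remainder
is nonnegative (`hE'`). -/
theorem charDeriv_mul_cos_pos (hc : 0 ≤ c) (hd : 0 ≤ d) (hB : B.Admissible 1) (hs : 0 < s)
    (h0 : charFn c d B s = 0) : 0 < charDeriv c d B s * cos (totalPhase c d B s) := by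
  set w := totalPhase c d B s with hw
  set θ := phase c d s 1 with hθ
  set τ := phaseDeriv c d s 1 with hτ
  set ρ := √(B.a0 ^ 2 + (s * B.b0) ^ 2) with hρ
  set X := ∑ i, B.a i * sin (phase c d s (B.η i)) with hX
  set Y := ∑ i, B.b i * (s * cos (phase c d s (B.η i))) with hY
  set X' := ∑ i, B.a i * (cos (phase c d s (B.η i)) * phaseDeriv c d s (B.η i)) with hX'
  set Y' := ∑ i, B.b i * (s * (-sin (phase c d s (B.η i)) * phaseDeriv c d s (B.η i))) with hY'
  have hamp : B.a0 * sin θ + B.b0 * (s * cos θ) = ρ * sin w := charFn_amplitude hB hs.le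
  have hamp' : B.a0 * cos θ - B.b0 * (s * sin θ) = ρ * cos w := charDeriv_amplitude hB hs.le
  have hXY : B.a0 * sin θ + B.b0 * (s * cos θ) = X + Y := sub_eq_zero.1 h0
  have hτpos : 0 < τ := phaseDeriv_one_pos hc hd
  have hr0 : ∀ i, 0 ≤ phaseDeriv c d s (B.η i) := fun i => phaseDeriv_nonneg hc hd (hB.η_mem i)
  have hr1 : ∀ i, phaseDeriv c d s (B.η i) ≤ τ := fun i => phaseDeriv_le (hB.η_mem i)
  have hρlt : B.sumA + s * B.sumB < ρ := hB.lt_amplitude hs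
  have hρpos : 0 < ρ := lt_of_le_of_lt
    (add_nonneg B.sumA_nonneg (mul_nonneg hs.le B.sumB_nonneg)) hρlt
  -- Pairing `X'` with `τ * X` lets each summand be bounded by planar Cauchy-Schwarz, without losing
  -- anything to the separate sizes of `X` and `X'`.
  have hA : cos w * X' + sin w * (τ * X) ≤ B.sumA * τ := by
    rw [hX', hX, BoundaryData.sumA, Finset.mul_sum, Finset.mul_sum, Finset.mul_sum,
      ← Finset.sum_add_distrib, Finset.sum_mul]
    refine Finset.sum_le_sum fun i _ => ?_
    have := mul_cos_add_mul_sin_le (w := w) (y := phase c d s (B.η i)) (hr0 i) (hr1 i)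
    calc _ = B.a i * (cos w * (cos (phase c d s (B.η i)) * phaseDeriv c d s (B.η i)) +
          sin w * (τ * sin (phase c d s (B.η i)))) := by ring
      _ ≤ |B.a i| * τ := by
        refine (le_abs_self _).trans ?_
        rw [abs_mul]
        exact mul_le_mul_of_nonneg_left this (abs_nonneg _)
  have hBb : cos w * Y' + sin w * (τ * Y) ≤ s * B.sumB * τ := by
    rw [hY', hY, BoundaryData.sumB, Finset.mul_sum, Finset.mul_sum, Finset.mul_sum,
      ← Finset.sum_add_distrib, Finset.mul_sum, Finset.sum_mul]
    refine Finset.sum_le_sum fun i _ => ?_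
    -- The derivative terms are the value terms with the phase advanced by a quarter turn.
    have := mul_cos_add_mul_sin_le (w := w) (y := phase c d s (B.η i) + π / 2) (hr0 i) (hr1 i)
    rw [cos_add_pi_div_two, sin_add_pi_div_two] at this
    calc _ = s * (B.b i * (cos w * (-sin (phase c d s (B.η i)) * phaseDeriv c d s (B.η i)) +
          sin w * (τ * cos (phase c d s (B.η i))))) := by ring
      _ ≤ s * (|B.b i| * τ) := by
        refine mul_le_mul_of_nonneg_left ((le_abs_self _).trans ?_) hs.le
        rw [abs_mul]
        exact mul_le_mul_of_nonneg_left this (abs_nonneg _)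
      _ = _ := by ring
  have hmain : cos w * (X' + Y') < ρ * τ * cos w ^ 2 := by
    -- Only here does `hmain` use that `s` is a root: `X + Y = ρ sin w`, so subtracting this term
    -- from `ρ * τ` leaves `ρ τ cos² w`.
    have h1 : sin w * (τ * (X + Y)) = ρ * τ * sin w ^ 2 := by rw [← hXY, hamp]; ring
    have h2 : (B.sumA + s * B.sumB) * τ < ρ * τ := mul_lt_mul_of_pos_right hρlt hτpos
    have h3 : ρ * τ * cos w ^ 2 = ρ * τ - ρ * τ * sin w ^ 2 := by
      linear_combination (ρ * τ) * sin_sq_add_cos_sq w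
    linarith
  obtain ⟨p, q, hp, hq, hpq, hpA, hqB⟩ := hB.exists_ratio
  have hXle : |X| ≤ p * B.a0 := hpA ▸ abs_sum_sin_le _
  have hYle : |Y| ≤ q * (s * B.b0) :=
    (abs_sum_cos_le hs.le _).trans (le_of_eq (by rw [hqB]; ring))
  have hcw : cos w ≠ 0 := by
    intro h
    rw [h] at hmain
    simp at hmain
  have hE : 0 ≤ (s * B.b0 * cos θ - Y) * cos w := by
    -- For `cos w < 0`, all of `X`, `Y`, `sin θ`, `cos θ` change sign to meet the hypothesis `hG`.
    rcases lt_or_gt_of_ne hcw with h | h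
    · have := remainder_nonneg_aux (X := -X) (Y := -Y) (S := -sin θ) (C := -cos θ)
        hB.a0_nonneg (mul_nonneg hs.le hB.b0_nonneg) hp hpq (by rwa [abs_neg])
        (by rwa [abs_neg]) (by rw [neg_sq, neg_sq, sin_sq_add_cos_sq]) (by linarith)
        (by nlinarith)
      exact mul_nonneg_of_nonpos_of_nonpos (by linarith) h.le
    · have := remainder_nonneg_aux (X := X) (Y := Y) (S := sin θ) (C := cos θ)
        hB.a0_nonneg (mul_nonneg hs.le hB.b0_nonneg) hp hpq hXle hYle
        (sin_sq_add_cos_sq _) (by linarith) (by nlinarith)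
      exact mul_nonneg this h.le
  have hYs : Y = s * ∑ i, B.b i * cos (phase c d s (B.η i)) := by
    rw [hY, Finset.mul_sum]
    exact Finset.sum_congr rfl fun i _ => by ring
  have hE' : 0 ≤ (B.b0 * cos θ - ∑ i, B.b i * cos (phase c d s (B.η i))) * cos w := by
    refine nonneg_of_mul_nonneg_right (a := s) ?_ hs
    calc 0 ≤ _ := hE
      _ = _ := by rw [hYs]; ring
  have hD : charDeriv c d B s = τ * (ρ * cos w) - (X' + Y') +
      (B.b0 * cos θ - ∑ i, B.b i * cos (phase c d s (B.η i))) := by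
    rw [← hamp', charDeriv]
    simp only [mul_add, Finset.sum_add_distrib]
    ring
  rw [hD, add_mul, sub_mul]
  nlinarith

end char

section roots
variable {c d s : ℝ} {B : BoundaryData}

/-! ### The total phase -/

theorem continuous_ang : Continuous (ang c d) :=
  continuous_iff_continuousAt.2 fun _ => hasDerivAt_ang.continuousAt

theorem continuous_phase (x : ℝ) : Continuous fun s => phase c d s x :=
  continuous_iff_continuousAt.2 fun _ => (hasDerivAt_phase x).continuousAt

theorem continuous_totalPhase : Continuous (totalPhase c d B) :=
  (continuous_phase 1).add continuous_ang

theorem continuous_charFn : Continuous (charFn c d B) :=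
  continuous_iff_continuousAt.2 fun _ => hasDerivAt_charFn.continuousAt

theorem strictMono_phase_one (hc : 0 ≤ c) (hd : 0 ≤ d) : StrictMono fun s => phase c d s 1 := by
  intro s t hst
  have := monotone_ang hc hd hst.le
  simp only [phase]
  linarith

theorem strictMono_totalPhase (hc : 0 ≤ c) (hd : 0 ≤ d) (hB : B.Admissible 1) :
    StrictMono (totalPhase c d B) := fun _ _ hst =>
  add_lt_add_of_lt_of_le (strictMono_phase_one hc hd hst)
    (monotone_ang hB.a0_nonneg hB.b0_nonneg hst.le)

theorem totalPhase_pos (hc : 0 ≤ c) (hd : 0 ≤ d) (hB : B.Admissible 1) (hs : 0 < s) :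
    0 < totalPhase c d B s := by
  have h1 := ang_nonneg hc hd hs.le
  have h2 := ang_nonneg hB.a0_nonneg hB.b0_nonneg hs.le
  unfold totalPhase phase
  linarith

theorem totalPhase_zero : totalPhase c d B 0 = ang c d 0 + ang B.a0 B.b0 0 := by
  simp [totalPhase, phase]

theorem totalPhase_zero_le : totalPhase c d B 0 ≤ π := by
  rw [totalPhase_zero]
  linarith [ang_le c d 0, ang_le B.a0 B.b0 0]

theorem totalPhase_zero_le_half (h : ¬(c = 0 ∧ B.a0 = 0)) : totalPhase c d B 0 ≤ π / 2 := by
  rw [totalPhase_zero]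
  by_cases hc : c = 0
  · rw [ang_zero (fun h' => h ⟨hc, h'⟩)]
    linarith [ang_le c d 0]
  · rw [ang_zero hc]
    linarith [ang_le B.a0 B.b0 0]

theorem exists_totalPhase_eq (hc : 0 ≤ c) (hd : 0 ≤ d) (hB : B.Admissible 1) {y : ℝ}
    (hy : totalPhase c d B 0 < y) : ∃ s, 0 < s ∧ totalPhase c d B s = y := by
  have h0 : totalPhase c d B |y| ≥ y := by
    have h1 := ang_nonneg hc hd (abs_nonneg y)
    have h2 := ang_nonneg hB.a0_nonneg hB.b0_nonneg (abs_nonneg y)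
    unfold totalPhase phase
    linarith [le_abs_self y, abs_nonneg y]
  obtain ⟨s, hs, hsy⟩ := intermediate_value_Icc (abs_nonneg y)
    (continuous_totalPhase (c := c) (d := d) (B := B)).continuousOn ⟨hy.le, h0⟩
  refine ⟨s, lt_of_le_of_ne hs.1 ?_, hsy⟩
  rintro rfl
  exact hy.ne hsy

/-! ### Signs of the characteristic function -/

/-- Here `|sin W| = 1`, so the single-point side has its full amplitude and dominates. -/
theorem charFn_sign (hB : B.Admissible 1) (hs : 0 < s) (j : ℕ)
    (h : totalPhase c d B s = π / 2 + j * π) : 0 < (-1) ^ j * charFn c d B s := by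
  have h1 := abs_sum_sin_le (B := B) fun i => phase c d s (B.η i)
  have h2 := abs_sum_cos_le (B := B) hs.le fun i => phase c d s (B.η i)
  have h3 := hB.lt_amplitude hs
  rw [charFn, charFn_amplitude hB hs.le, h, sin_add_nat_mul_pi, sin_pi_div_two, mul_one]
  obtain ⟨h1a, h1b⟩ := abs_le.1 h1
  obtain ⟨h2a, h2b⟩ := abs_le.1 h2
  rcases neg_one_pow_eq_or ℝ j with hj | hj <;> rw [hj] <;> linarith

theorem neg_one_pow_mul_cos_nonpos {j : ℕ} {w : ℝ} (h1 : π / 2 + j * π ≤ w)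
    (h2 : w ≤ π / 2 + (j + 1 : ℕ) * π) : (-1) ^ j * cos w ≤ 0 := by
  push_cast at h2
  have h3 : 0 ≤ cos (w - (j + 1 : ℕ) * π) :=
    cos_nonneg_of_neg_pi_div_two_le_of_le (by push_cast; linarith) (by push_cast; linarith)
  rw [cos_sub_nat_mul_pi, pow_succ] at h3
  linarith

/-- In window `j` the sign of `cos W` is opposite to `(-1)^j`, so every zero there is crossed in the
same direction. -/
theorem neg_one_pow_mul_charDeriv_neg (hc : 0 ≤ c) (hd : 0 ≤ d) (hB : B.Admissible 1)
    (hs : 0 < s) (h0 : charFn c d B s = 0) {j : ℕ} (h1 : π / 2 + j * π ≤ totalPhase c d B s)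
    (h2 : totalPhase c d B s ≤ π / 2 + (j + 1 : ℕ) * π) :
    0 < -((-1) ^ j * charDeriv c d B s) := by
  have h3 := charDeriv_mul_cos_pos hc hd hB hs h0
  have h4 := neg_one_pow_mul_cos_nonpos h1 h2
  rcases neg_one_pow_eq_or ℝ j with hj | hj <;> rw [hj] at h4 ⊢
  · by_contra! h
    nlinarith
  · by_contra! h
    nlinarith

/-- Within a window of the total phase, a sign once taken is kept. -/
theorem charFn_sign_propagates (hc : 0 ≤ c) (hd : 0 ≤ d) (hB : B.Admissible 1) {j : ℕ} {x y : ℝ}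
    (hx : 0 < x) (hxy : x < y) (h1 : π / 2 + j * π ≤ totalPhase c d B x)
    (h2 : totalPhase c d B y ≤ π / 2 + (j + 1 : ℕ) * π) (h : (-1) ^ j * charFn c d B x ≤ 0) :
    (-1) ^ j * charFn c d B y < 0 := by
  have hm := (strictMono_totalPhase hc hd hB).monotone
  have := pos_of_deriv_pos_at_zeros (f := fun s => -((-1) ^ j * charFn c d B s))
    (f' := fun s => -((-1) ^ j * charDeriv c d B s)) (a := x) (b := y)
    (fun s _ => (hasDerivAt_charFn.const_mul _).fun_neg) (by simpa using h)
    (fun s hs h0 => neg_one_pow_mul_charDeriv_neg hc hd hB (hx.trans_le hs.1)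
      (by simpa using h0) (h1.trans (hm hs.1)) ((hm hs.2).trans h2)) y ⟨hxy, le_rfl⟩
  linarith

theorem sum_mul_le {m : ℕ} (b r : Fin m → ℝ) {t : ℝ} (h : ∀ i, |r i| ≤ t) :
    ∑ i, b i * r i ≤ (∑ i, |b i|) * t := by
  rw [Finset.sum_mul]
  refine Finset.sum_le_sum fun i _ => (le_abs_self _).trans ?_
  rw [abs_mul]
  exact mul_le_mul_of_nonneg_left (h i) (abs_nonneg _)

/-- The leading behaviour at `s = 0` decides: `F(0) = a0 - ∑ a i` if `c = 0`; `F / s → b0 - ∑ b i`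
if `a0 = 0`; otherwise `F(0) = 0` and `F'(0) > 0`. -/
theorem eventually_charFn_pos (hc : 0 ≤ c) (hd : 0 ≤ d) (hB : B.Admissible 1)
    (h : ¬(c = 0 ∧ B.a0 = 0)) : ∀ᶠ s in 𝓝[>] 0, 0 < charFn c d B s := by
  have hSb : ∑ i, B.b i ≤ B.sumB := Finset.sum_le_sum fun i _ => le_abs_self _
  by_cases hc0 : c = 0
  · subst hc0
    have ha : B.a0 ≠ 0 := fun h' => h ⟨rfl, h'⟩
    have hlt := hB.sumA_lt (lt_of_le_of_ne hB.a0_nonneg ha.symm)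
    have hSa : ∑ i, B.a i ≤ B.sumA := Finset.sum_le_sum fun i _ => le_abs_self _
    have h0 : 0 < charFn 0 d B 0 := by
      simp only [charFn, phase, ang_of_zero, zero_mul, zero_add, sin_pi_div_two, mul_one,
        mul_zero, Finset.sum_const_zero, add_zero]
      linarith
    exact (continuous_charFn.continuousAt.eventually (eventually_gt_nhds h0)).filter_mono
      nhdsWithin_le_nhds
  by_cases ha : B.a0 = 0
  · have hb := hB.b0_pos ha
    have hcont : Continuous fun s => B.b0 * cos (phase c d s 1) -
        ∑ i, B.b i * cos (phase c d s (B.η i)) :=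
      ((continuous_cos.comp (continuous_phase 1)).const_mul _).sub
        (continuous_finsetSum _ fun i _ => (continuous_cos.comp (continuous_phase _)).const_mul _)
    have h0 : 0 < B.b0 * cos (phase c d 0 1) - ∑ i, B.b i * cos (phase c d 0 (B.η i)) := by
      simp only [phase, ang_zero hc0, zero_mul, zero_add, cos_zero, mul_one]
      linarith [hB.sumB_lt hb]
    have hev := (hcont.continuousAt.eventually (eventually_gt_nhds h0)).filter_mono
      (nhdsWithin_le_nhds (s := Ioi 0))
    filter_upwards [hev, self_mem_nhdsWithin] with s hs1 hs2
    have : charFn c d B s = s * (B.b0 * cos (phase c d s 1) -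
        ∑ i, B.b i * cos (phase c d s (B.η i))) := by
      simp only [charFn, ha, hB.a_eq_zero ha, zero_mul, Finset.sum_const_zero, zero_add, mul_sub,
        Finset.mul_sum]
      congr 1
      · ring
      · exact Finset.sum_congr rfl fun i _ => by ring
    rw [this]
    exact mul_pos hs2 hs1
  · have ha' : 0 < B.a0 := lt_of_le_of_ne hB.a0_nonneg (Ne.symm ha)
    have h0 : charFn c d B 0 = 0 := by simp [charFn, phase, ang_zero hc0]
    have hτ := phaseDeriv_one_pos (s := 0) hc hd
    have hd0 : 0 < charDeriv c d B 0 := by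
      simp only [charDeriv, phase, ang_zero hc0, zero_mul, cos_zero, one_mul, add_zero,
        mul_one]
      have h1 : ∑ i, B.a i * phaseDeriv c d 0 (B.η i) ≤ B.sumA * phaseDeriv c d 0 1 :=
        sum_mul_le _ _ fun i => by
          rw [abs_of_nonneg (phaseDeriv_nonneg hc hd (hB.η_mem i))]
          exact phaseDeriv_le (hB.η_mem i)
      have h2 := mul_lt_mul_of_pos_right (hB.sumA_lt ha') hτ
      linarith [hB.sumB_le]
    have hs := (hasDerivAt_iff_tendsto_slope.1 (hasDerivAt_charFn (c := c) (d := d)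
      (B := B) (s := 0))).eventually (eventually_gt_nhds hd0)
    have hs' : ∀ᶠ y in 𝓝[>] 0, 0 < slope (charFn c d B) 0 y :=
      hs.filter_mono (nhdsWithin_mono _ fun y hy => ne_of_gt hy)
    filter_upwards [hs', self_mem_nhdsWithin] with s hs1 hs2
    rw [slope_def_field, h0, sub_zero, sub_zero] at hs1
    exact (div_pos_iff_of_pos_right hs2).1 hs1

theorem eventually_charFn_neg (hB : B.Admissible 1) (ha : B.a0 = 0) :
    ∀ᶠ s in 𝓝[>] 0, charFn 0 d B s < 0 := by
  have hb := hB.b0_pos ha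
  -- With `s < π / 4`, all `s * (η i + 1)` lie in `[0, 2 s]`, where the sine is increasing; so the
  -- term at `1` dominates.
  have hmem : Ioo (0 : ℝ) (π / 4) ∈ 𝓝[>] (0 : ℝ) := Ioo_mem_nhdsGT (by positivity)
  filter_upwards [hmem] with s hs
  have hpos : 0 < sin (s * (1 + 1)) :=
    sin_pos_of_pos_of_lt_pi (by linarith [hs.1]) (by linarith [hs.2, pi_pos])
  have h1 : ∑ i, B.b i * sin (s * (B.η i + 1)) ≤ B.sumB * sin (s * (1 + 1)) := by
    refine sum_mul_le _ _ fun i => ?_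
    have h0 : 0 ≤ s * (B.η i + 1) := mul_nonneg hs.1.le (by linarith [(hB.η_mem i).1])
    have h2 : s * (B.η i + 1) ≤ s * (1 + 1) :=
      mul_le_mul_of_nonneg_left (by linarith [(hB.η_mem i).2]) hs.1.le
    have h3 : s * (1 + 1) ≤ π / 2 := by linarith [hs.2]
    rw [abs_of_nonneg (sin_nonneg_of_nonneg_of_le_pi h0 (by linarith))]
    exact sin_le_sin_of_le_of_le_pi_div_two (by linarith [pi_pos]) h3 h2
  have h2 : B.sumB * sin (s * (1 + 1)) < B.b0 * sin (s * (1 + 1)) :=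
    mul_lt_mul_of_pos_right (hB.sumB_lt hb) hpos
  have : charFn 0 d B s =
      -(s * (B.b0 * sin (s * (1 + 1)) - ∑ i, B.b i * sin (s * (B.η i + 1)))) := by
    simp only [charFn, phase, ang_of_zero, ha, hB.a_eq_zero ha, zero_mul, Finset.sum_const_zero,
      zero_add, cos_add_pi_div_two, mul_neg, Finset.sum_neg_distrib, mul_sub, Finset.mul_sum]
    rw [neg_sub, sub_neg_eq_add, neg_add_eq_sub]
    congr 1
    · exact Finset.sum_congr rfl fun i _ => by ring
    · ring
  rw [this, neg_lt_zero]
  exact mul_pos hs.1 (by linarith)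

/-- No root lies before the first window: `F` starts positive, and as `cos W ≥ 0` it can cross zero
only upwards. -/
theorem charFn_pos_of_totalPhase_le (hc : 0 ≤ c) (hd : 0 ≤ d) (hB : B.Admissible 1)
    (h : ¬(c = 0 ∧ B.a0 = 0)) (hs : 0 < s) (hw : totalPhase c d B s ≤ π / 2) :
    0 < charFn c d B s := by
  obtain ⟨a, ha, has⟩ :=
    ((eventually_charFn_pos hc hd hB h).and (Ioo_mem_nhdsGT hs)).exists
  refine pos_of_deriv_pos_at_zeros (f := charFn c d B) (f' := charDeriv c d B) (a := a) (b := s)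
    (fun x _ => hasDerivAt_charFn) ha.le (fun x hx h0 => ?_) s ⟨has.2, le_rfl⟩
  have hx0 : 0 < x := has.1.trans_le hx.1
  have h3 := charDeriv_mul_cos_pos hc hd hB hx0 h0
  have h4 : 0 ≤ cos (totalPhase c d B x) := cos_nonneg_of_neg_pi_div_two_le_of_le
    (by linarith [totalPhase_pos hc hd hB hx0, pi_pos])
    (((strictMono_totalPhase hc hd hB).monotone hx.2).trans hw)
  exact pos_of_mul_pos_left h3 h4

/-- With Neumann type at both ends `W` starts at `π`, inside window `0`, and `F` is already
negative; so that window has no positive root and is represented by `0`. -/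
theorem charFn_neg_of_totalPhase_le (hd : 0 ≤ d) (hB : B.Admissible 1)
    (ha : B.a0 = 0) (hs : 0 < s) (hw : totalPhase 0 d B s ≤ π / 2 + (0 + 1 : ℕ) * π) :
    charFn 0 d B s < 0 := by
  obtain ⟨a, ha1, has⟩ :=
    ((eventually_charFn_neg (d := d) hB ha).and (Ioo_mem_nhdsGT hs)).exists
  have h0 : totalPhase 0 d B 0 = π := by rw [totalPhase_zero, ha, ang_of_zero, ang_of_zero]; ring
  have h1 := strictMono_totalPhase (B := B) le_rfl hd hB has.1
  simpa using charFn_sign_propagates (j := 0) le_rfl hd hB has.1 has.2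
    (by rw [Nat.cast_zero]; linarith [pi_pos]) hw (by simpa using ha1.le)

/-! ### The sequence of roots -/

/-- `z` is the root of the characteristic function in the window of the total phase with index
`k`; in the Neumann case the root of the first window is `0`. -/
structure IsRootInWindow (c d : ℝ) (B : BoundaryData) (k : ℕ) (z : ℝ) : Prop where
  nonneg : 0 ≤ z
  root : (0 < z ∧ charFn c d B z = 0) ∨ (z = 0 ∧ k = 0 ∧ c = 0 ∧ B.a0 = 0)
  left_lt : π / 2 + k * π < totalPhase c d B z
  lt_right : totalPhase c d B z < π / 2 + (k + 1 : ℕ) * π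
  sign_before : ∀ s, 0 < s → π / 2 + k * π ≤ totalPhase c d B s → s < z →
    0 < (-1) ^ k * charFn c d B s
  sign_after : ∀ s, z < s → totalPhase c d B s ≤ π / 2 + (k + 1 : ℕ) * π →
    (-1) ^ k * charFn c d B s < 0

theorem exists_window_left (hc : 0 ≤ c) (hd : 0 ≤ d) (hB : B.Admissible 1) (k : ℕ)
    (h : ¬(k = 0 ∧ c = 0 ∧ B.a0 = 0)) : ∃ a, 0 < a ∧ π / 2 + k * π ≤ totalPhase c d B a ∧
      totalPhase c d B a < π / 2 + (k + 1 : ℕ) * π ∧ 0 < (-1) ^ k * charFn c d B a := by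
  have hπ := pi_pos
  by_cases h0 : totalPhase c d B 0 < π / 2 + k * π
  · obtain ⟨a, ha, haw⟩ := exists_totalPhase_eq hc hd hB h0
    exact ⟨a, ha, haw.ge, by rw [haw]; push_cast; linarith, charFn_sign hB ha k haw⟩
  -- Since `W(0) ≤ π`, only window `0` can fail to have its left edge at a positive `s`; then a
  -- small `s` replaces the edge.
  · have hk : k = 0 := by
      by_contra hk
      have : (1 : ℝ) ≤ k := by exact_mod_cast Nat.one_le_iff_ne_zero.2 hk
      have := totalPhase_zero_le (c := c) (d := d) (B := B)
      nlinarith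
    subst hk
    have hN : ¬(c = 0 ∧ B.a0 = 0) := fun h' => h ⟨rfl, h'⟩
    have hle := totalPhase_zero_le_half (d := d) hN
    have hw : ∀ᶠ s in 𝓝[>] 0, totalPhase c d B s < π / 2 + (0 + 1 : ℕ) * π :=
      (continuous_totalPhase.continuousAt.eventually
        (eventually_lt_nhds (by push_cast; linarith))).filter_mono nhdsWithin_le_nhds
    obtain ⟨a, ⟨ha, haw⟩, ha0⟩ :=
      (((eventually_charFn_pos hc hd hB hN).and hw).and self_mem_nhdsWithin).exists
    refine ⟨a, ha0, ?_, haw, by simpa using ha⟩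
    exact (not_lt.1 h0).trans ((strictMono_totalPhase hc hd hB).monotone (le_of_lt ha0))

/-- Opposite signs at the two ends give existence; the common crossing direction gives the two sign
fields, which encode uniqueness. -/
theorem exists_root (hc : 0 ≤ c) (hd : 0 ≤ d) (hB : B.Admissible 1) (k : ℕ) :
    ∃ z, IsRootInWindow c d B k z := by
  have hπ := pi_pos
  have hmono := strictMono_totalPhase hc hd hB
  by_cases hN : k = 0 ∧ c = 0 ∧ B.a0 = 0
  · obtain ⟨rfl, rfl, ha⟩ := hN
    have h0 : totalPhase 0 d B 0 = π := by
      rw [totalPhase_zero, ha, ang_of_zero, ang_of_zero]; ring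
    refine ⟨0, le_rfl, Or.inr ⟨rfl, rfl, rfl, ha⟩, ?_, ?_, fun s hs _ hs' => absurd hs' hs.not_gt,
      fun s hs hw => ?_⟩
    · rw [h0]; push_cast; linarith
    · rw [h0]; push_cast; linarith
    · simpa using charFn_neg_of_totalPhase_le hd hB ha hs hw
  obtain ⟨a, ha, ha1, ha2, hpos⟩ := exists_window_left hc hd hB k hN
  obtain ⟨b, hb, hbw⟩ := exists_totalPhase_eq (y := π / 2 + (k + 1 : ℕ) * π) hc hd hB
    ((hmono ha).trans ha2)
  have hab : a < b := hmono.lt_iff_lt.1 (by rw [hbw]; exact ha2)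
  have hneg : (-1) ^ k * charFn c d B b < 0 := by
    have := charFn_sign hB hb (k + 1) hbw
    rw [pow_succ] at this
    linarith
  obtain ⟨z, hz, hz0⟩ := intermediate_value_Icc' (f := fun s => (-1) ^ k * charFn c d B s) hab.le
    (continuous_charFn.const_mul _).continuousOn ⟨hneg.le, hpos.le⟩
  have hzpos : 0 < z := ha.trans_le hz.1
  have hz0' : charFn c d B z = 0 := by simpa using hz0
  have hleft := ha1.trans (hmono.monotone hz.1)
  have hright := (hmono.monotone hz.2).trans hbw.le
  refine ⟨z, hzpos.le, Or.inl ⟨hzpos, hz0'⟩, lt_of_le_of_ne hleft fun h => ?_,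
    lt_of_le_of_ne hright fun h => ?_, fun s hs hw hsz => ?_, fun s hsz hw => ?_⟩
  · have := charFn_sign hB hzpos k h.symm
    simp [hz0'] at this
  · have := charFn_sign hB hzpos (k + 1) h
    simp [hz0'] at this
  · by_contra! h
    have := charFn_sign_propagates hc hd hB hs hsz hw hright h
    simp [hz0'] at this
  · exact charFn_sign_propagates hc hd hB hzpos hsz hleft hw (by simp [hz0'])

theorem strictMono_roots (hc : 0 ≤ c) (hd : 0 ≤ d) (hB : B.Admissible 1) {r : ℕ → ℝ}
    (hr : ∀ k, IsRootInWindow c d B k (r k)) : StrictMono r :=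
  strictMono_nat_of_lt_succ fun k => (strictMono_totalPhase hc hd hB).lt_iff_lt.1
    ((hr k).lt_right.trans (hr (k + 1)).left_lt)

theorem exists_eq_root (hc : 0 ≤ c) (hd : 0 ≤ d) (hB : B.Admissible 1) {r : ℕ → ℝ}
    (hr : ∀ k, IsRootInWindow c d B k (r k)) (hs : 0 < s) (h0 : charFn c d B s = 0) :
    ∃ k, r k = s := by
  have hπ := pi_pos
  have hw : π / 2 < totalPhase c d B s := by
    by_contra! h
    by_cases hN : c = 0 ∧ B.a0 = 0
    · obtain ⟨rfl, ha⟩ := hN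
      have h1 : totalPhase 0 d B 0 = π := by
        rw [totalPhase_zero, ha, ang_of_zero, ang_of_zero]; ring
      have := strictMono_totalPhase hc hd hB hs
      linarith
    · exact (charFn_pos_of_totalPhase_le hc hd hB hN hs h).ne' h0
  -- The integer part of `y` is the index of the window containing `s`.
  set y := (totalPhase c d B s - π / 2) / π with hy
  have hy0 : 0 ≤ y := div_nonneg (by linarith) hπ.le
  have hyw : totalPhase c d B s = π / 2 + y * π := by rw [hy]; field_simp; ring
  have h1 : π / 2 + (⌊y⌋₊ : ℝ) * π ≤ totalPhase c d B s := by
    rw [hyw]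
    have := mul_le_mul_of_nonneg_right (Nat.floor_le hy0) hπ.le
    linarith
  have h2 : totalPhase c d B s ≤ π / 2 + (⌊y⌋₊ + 1 : ℕ) * π := by
    rw [hyw]
    push_cast
    have := mul_le_mul_of_nonneg_right (Nat.lt_floor_add_one y).le hπ.le
    linarith
  refine ⟨⌊y⌋₊, ?_⟩
  rcases lt_trichotomy (r ⌊y⌋₊) s with h | h | h
  · have := (hr ⌊y⌋₊).sign_after s h h2
    simp [h0] at this
  · exact h
  · have := (hr ⌊y⌋₊).sign_before s hs h1 h
    simp [h0] at this

end roots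

/-! ### Solutions of the differential equation -/

theorem uniqueDiffOn_I : UniqueDiffOn ℝ I := uniqueDiffOn_Icc (by norm_num)

theorem left_mem_I : (-1 : ℝ) ∈ I := ⟨le_rfl, by norm_num⟩

theorem right_mem_I : (1 : ℝ) ∈ I := ⟨by norm_num, le_rfl⟩

theorem D_eq_of_eqOn {u w w' : ℝ → ℝ} (hu : EqOn u w I) {x : ℝ} (hx : x ∈ I)
    (hw : HasDerivAt w (w' x) x) : D u x = w' x := by
  rw [D, derivWithin_congr hu (hu hx)]
  exact hw.hasDerivWithinAt.derivWithin (uniqueDiffOn_I x hx)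

section solutions
variable {u : ℝ → ℝ} {lam : ℝ}

theorem hasDerivWithinAt_D (hu : ContDiffOn ℝ 2 u I) {x : ℝ} (hx : x ∈ I) :
    HasDerivWithinAt u (D u x) I x :=
  ((hu.differentiableOn (by norm_num)) x hx).hasDerivWithinAt

theorem contDiffOn_D (hu : ContDiffOn ℝ 2 u I) : ContDiffOn ℝ 1 (D u) I :=
  hu.derivWithin uniqueDiffOn_I (by norm_num)

/-- The differential equation extends to the closed interval. -/
theorem D_D_eq (hu : ContDiffOn ℝ 2 u I) (h : ∀ x ∈ Ioo (-1 : ℝ) 1, -D (D u) x = lam * u x) :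
    ∀ x ∈ I, D (D u) x = -lam * u x := by
  have h1 : ContinuousOn (D (D u)) I :=
    ((contDiffOn_D hu).continuousOn_derivWithin uniqueDiffOn_I le_rfl)
  have h2 : ContinuousOn (fun x => -lam * u x) I := hu.continuousOn.const_mul _
  have hcl : closure (Ioo (-1 : ℝ) 1) = I := closure_Ioo (by norm_num)
  have h3 : EqOn (D (D u)) (fun x => -lam * u x) (Ioo (-1) 1) := fun x hx => by
    have := h x hx
    simp only
    linarith
  exact h3.of_subset_closure h1 h2 Ioo_subset_Icc_self hcl.ge

theorem hasDerivWithinAt_D_D (hu : ContDiffOn ℝ 2 u I)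
    (h : ∀ x ∈ Ioo (-1 : ℝ) 1, -D (D u) x = lam * u x) {x : ℝ} (hx : x ∈ I) :
    HasDerivWithinAt (D u) (-lam * u x) I x := by
  rw [← D_D_eq hu h x hx]
  exact (((contDiffOn_D hu).differentiableOn one_ne_zero) x hx).hasDerivWithinAt

/-- A solution that satisfies the Robin condition at `-1` is a multiple of any nontrivial one. -/
theorem exists_eq_const_mul {w w' : ℝ → ℝ} {c d : ℝ} (hcd : 0 < c ^ 2 + d ^ 2)
    (hu : ContDiffOn ℝ 2 u I) (h : ∀ x ∈ Ioo (-1 : ℝ) 1, -D (D u) x = lam * u x)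
    (hbc : c * u (-1) = d * D u (-1)) (hw : ∀ x, HasDerivAt w (w' x) x)
    (hw' : ∀ x, HasDerivAt w' (-lam * w x) x) {k : ℝ} (hk : k ≠ 0) (hw0 : w (-1) = k * d)
    (hw0' : w' (-1) = k * c) :
    ∃ C, ∀ x ∈ I, u x = C * w x ∧ D u x = C * w' x := by
  -- The initial vector of `u` is parallel to `(d, c)`; the constant is its projection on that
  -- direction, scaled by `k`.
  refine ⟨(d * u (-1) + c * D u (-1)) / (k * (c ^ 2 + d ^ 2)), ?_⟩
  set C := (d * u (-1) + c * D u (-1)) / (k * (c ^ 2 + d ^ 2)) with hC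
  have hC0 : u (-1) = C * w (-1) := by
    rw [hw0, hC]
    field_simp
    linear_combination c * hbc
  have hC1 : D u (-1) = C * w' (-1) := by
    rw [hw0', hC]
    field_simp
    linear_combination (-d) * hbc
  let A : ℝ × ℝ →L[ℝ] ℝ × ℝ :=
    (ContinuousLinearMap.snd ℝ ℝ ℝ).prod ((-lam) • ContinuousLinearMap.fst ℝ ℝ ℝ)
  -- Derivatives within `I` serve as right derivatives, as the uniqueness theorem requires.
  have hI : ∀ x ∈ Ico (-1 : ℝ) 1, I ∈ 𝓝[Ici x] x := fun x hx =>
    mem_of_superset (Icc_mem_nhdsGE hx.2) (Icc_subset_Icc_left hx.1)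
  have key : EqOn (fun x => (u x, D u x)) (fun x => (C * w x, C * w' x)) (Icc (-1) 1) := by
    refine ODE_solution_unique_of_mem_Icc_right (v := fun _ p => A p) (s := fun _ => univ)
      (K := ‖A‖₊) (fun t _ => A.lipschitz.lipschitzOnWith)
      (hu.continuousOn.prodMk (contDiffOn_D hu).continuousOn) (fun t ht => ?_)
      (fun t _ => mem_univ _) ?_ (fun t ht => ?_) (fun t _ => mem_univ _) ?_
    · have htI : t ∈ I := ⟨ht.1, ht.2.le⟩
      have := (hasDerivWithinAt_D hu htI).prodMk (hasDerivWithinAt_D_D hu h htI)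
      exact this.mono_of_mem_nhdsWithin (hI t ht)
    · exact fun x _ => ((((hw x).const_mul C).prodMk
        ((hw' x).const_mul C)).continuousAt).continuousWithinAt
    · convert (((hw t).const_mul C).prodMk ((hw' t).const_mul C)).hasDerivWithinAt using 1
      simp only [A, ContinuousLinearMap.prod_apply, FunLike.coe_smul, Pi.smul_apply,
        ContinuousLinearMap.coe_snd', ContinuousLinearMap.coe_fst', smul_eq_mul]
      exact Prod.ext rfl (by ring)
    · exact Prod.ext hC0 hC1
  intro x hx
  have := key hx
  exact ⟨congrArg Prod.fst this, congrArg Prod.snd this⟩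

end solutions

/-! ### Eigenvalues as squares of the roots -/

section spectrum
variable {c d s lam : ℝ} {B : BoundaryData} {u : ℝ → ℝ}

/-- The eigenvalue problem with the condition `c * u(-1) = d * u'(-1)` on the left. -/
abbrev IsEigen (c d : ℝ) (B : BoundaryData) : ℝ → (ℝ → ℝ) → Prop :=
  IsEigenfunction (fun u => c * u (-1) = d * D u (-1)) (B.Holds 1)

theorem hasDerivAt_sin_phase_right (x : ℝ) :
    HasDerivAt (fun x => sin (phase c d s x)) (s * cos (phase c d s x)) x := by
  have : HasDerivAt (fun x => phase c d s x) s x := by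
    unfold phase
    simpa using (((hasDerivAt_id x).add_const 1).const_mul s).add_const (ang c d s)
  simpa [mul_comm] using this.sin

theorem hasDerivAt_cos_phase_right (x : ℝ) :
    HasDerivAt (fun x => s * cos (phase c d s x)) (-s ^ 2 * sin (phase c d s x)) x := by
  have : HasDerivAt (fun x => phase c d s x) s x := by
    unfold phase
    simpa using (((hasDerivAt_id x).add_const 1).const_mul s).add_const (ang c d s)
  exact (this.cos.const_mul s).congr_deriv (by ring)

/-- The explicit form of an eigenfunction with constant `C`. -/
def IsSineOn (c d s C : ℝ) (u : ℝ → ℝ) : Prop :=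
  ∀ x ∈ I, u x = C * sin (phase c d s x) ∧ D u x = C * (s * cos (phase c d s x)) ∧
    D (D u) x = -s ^ 2 * (C * sin (phase c d s x))

theorem phase_neg_one : phase c d s (-1) = ang c d s := by simp [phase]

/-- The sine solution has initial values proportional to `(d, c)`, also for `s = 0` if `c = 0`. -/
theorem left_values (hc : 0 ≤ c) (hd : 0 ≤ d) (hcd : 0 < c + d) (hs : 0 ≤ s) (hs0 : s = 0 → c = 0) :
    ∃ k, k ≠ 0 ∧ sin (phase c d s (-1)) = k * d ∧ s * cos (phase c d s (-1)) = k * c := by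
  rw [phase_neg_one]
  rcases hs.lt_or_eq with h | h
  · have h0 : 0 < c ^ 2 + (s * d) ^ 2 := by
      rcases hc.lt_or_eq with h' | h'
      · positivity
      · have : 0 < d := by linarith
        positivity
    have h1 := cos_ang (d := d) (s := s) hc
    have h2 := sin_ang hc hd hs
    have h3 : 0 < √(c ^ 2 + (s * d) ^ 2) := sqrt_pos.2 h0
    refine ⟨s / √(c ^ 2 + (s * d) ^ 2), by positivity, ?_, ?_⟩
    · rw [div_mul_eq_mul_div, eq_div_iff h3.ne']; linear_combination h2
    · rw [div_mul_eq_mul_div, eq_div_iff h3.ne']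
      linear_combination s * h1
  · have hc0 := hs0 h.symm
    subst hc0
    have : d ≠ 0 := by linarith
    refine ⟨1 / d, by positivity, ?_, ?_⟩
    · rw [ang_of_zero, sin_pi_div_two]; field_simp
    · rw [← h]; ring

theorem isEigen_isSineOn (hc : 0 ≤ c) (hd : 0 ≤ d) (hcd : 0 < c + d) (hs : 0 ≤ s)
    (hs0 : s = 0 → c = 0) (h : IsEigen c d B (s ^ 2) u) : ∃ C, C ≠ 0 ∧ IsSineOn c d s C u := by
  obtain ⟨k, hk, h1, h2⟩ := left_values hc hd hcd hs hs0
  have hcd2 : 0 < c ^ 2 + d ^ 2 := by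
    rcases hc.lt_or_eq with h' | h'
    · positivity
    · have : 0 < d := by linarith
      positivity
  obtain ⟨C, hC⟩ := exists_eq_const_mul hcd2 h.contDiffOn h.ode h.left
    (fun x => hasDerivAt_sin_phase_right (c := c) (d := d) (s := s) x)
    (fun x => hasDerivAt_cos_phase_right x) hk h1 h2
  refine ⟨C, ?_, fun x hx => ⟨(hC x hx).1, (hC x hx).2, ?_⟩⟩
  · rintro rfl
    obtain ⟨x, hx, hx0⟩ := h.nontrivial
    exact hx0 (by simpa using (hC x hx).1)
  · rw [D_D_eq h.contDiffOn h.ode x hx, (hC x hx).1]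

theorem holds_iff_charFn (hB : B.Admissible 1) {C : ℝ} (hC : C ≠ 0) (h : IsSineOn c d s C u) :
    B.Holds 1 u ↔ charFn c d B s = 0 := by
  have h1 : ∀ i, B.a i * u (B.η i) = C * (B.a i * sin (phase c d s (B.η i))) := fun i => by
    rw [(h _ (hB.η_mem i)).1]; ring
  have h2 : ∀ i, B.b i * D u (B.η i) = C * (B.b i * (s * cos (phase c d s (B.η i)))) := fun i => by
    rw [(h _ (hB.η_mem i)).2.1]; ring
  rw [BoundaryData.Holds, (h 1 right_mem_I).1, (h 1 right_mem_I).2.1, ← sub_eq_zero,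
    Finset.sum_congr rfl fun i _ => h1 i, Finset.sum_congr rfl fun i _ => h2 i,
    ← Finset.mul_sum, ← Finset.mul_sum]
  have : B.a0 * (C * sin (phase c d s 1)) + B.b0 * (C * (s * cos (phase c d s 1))) -
      (C * ∑ i, B.a i * sin (phase c d s (B.η i)) +
        C * ∑ i, B.b i * (s * cos (phase c d s (B.η i)))) = C * charFn c d B s := by
    rw [charFn]; ring
  rw [this, mul_eq_zero, or_iff_right hC]

theorem isEigen_sine (hc : 0 ≤ c) (hd : 0 ≤ d) (hcd : 0 < c + d) (hB : B.Admissible 1)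
    (hs : 0 ≤ s) (hs0 : s = 0 → c = 0) (h : charFn c d B s = 0) :
    IsEigen c d B (s ^ 2) fun x => sin (phase c d s x) := by
  have hD : EqOn (D fun x => sin (phase c d s x)) (fun x => s * cos (phase c d s x)) I :=
    fun x hx => D_eq_of_eqOn (w' := fun x => s * cos (phase c d s x)) (fun _ _ => rfl) hx
      (hasDerivAt_sin_phase_right x)
  have hDD : ∀ x ∈ I, D (D fun x => sin (phase c d s x)) x = -s ^ 2 * sin (phase c d s x) :=
    fun x hx => D_eq_of_eqOn (w' := fun x => -s ^ 2 * sin (phase c d s x)) hD hx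
      (hasDerivAt_cos_phase_right x)
  have hsine : IsSineOn c d s 1 fun x => sin (phase c d s x) := fun x hx => by
    refine ⟨by ring, by rw [hD hx, one_mul], by rw [hDD x hx, one_mul]⟩
  obtain ⟨k, hk, h1, h2⟩ := left_values hc hd hcd hs hs0
  refine ⟨?_, fun x hx => ?_, ?_, (holds_iff_charFn hB one_ne_zero hsine).2 h, ?_⟩
  · unfold phase
    fun_prop
  · rw [hDD x (Ioo_subset_Icc_self hx)]; ring
  · simp only
    rw [hD left_mem_I]
    simp only
    rw [h1, h2]; ring
  -- If the sine vanished on `I`, both its initial values, multiples of `d` and `c`, would be zero.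
  · by_contra! h0
    have hd0 : d = 0 := by
      have := h0 (-1) left_mem_I
      rw [h1] at this
      exact (mul_eq_zero.1 this).resolve_left hk
    have hc0 : k * c = 0 := h2.symm.trans <| (hD left_mem_I).symm.trans <|
      D_eq_of_eqOn (w := fun _ => 0) (w' := fun _ => 0) h0 left_mem_I (hasDerivAt_const _ _)
    have := (mul_eq_zero.1 hc0).resolve_left hk
    linarith

/-- A positive nondecreasing function with nondecreasing derivative violates the boundary condition
at `1`, unless all terms with values are absent and the derivative vanishes at `1`. -/
theorem not_holds_of_monotone (hB : B.Admissible 1) {w w' : ℝ → ℝ}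
    (h0 : ∀ x ∈ I, 0 ≤ w x ∧ w x ≤ w 1) (h1 : ∀ x ∈ I, 0 ≤ w' x ∧ w' x ≤ w' 1) (hpos : 0 < w 1)
    (h : B.a0 ≠ 0 ∨ 0 < w' 1) : B.a0 * w 1 + B.b0 * w' 1 ≠
      ∑ i, B.a i * w (B.η i) + ∑ i, B.b i * w' (B.η i) := by
  have hA : ∑ i, B.a i * w (B.η i) ≤ B.sumA * w 1 := sum_mul_le _ _ fun i => by
    rw [abs_of_nonneg (h0 _ (hB.η_mem i)).1]; exact (h0 _ (hB.η_mem i)).2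
  have hBb : ∑ i, B.b i * w' (B.η i) ≤ B.sumB * w' 1 := sum_mul_le _ _ fun i => by
    rw [abs_of_nonneg (h1 _ (hB.η_mem i)).1]; exact (h1 _ (hB.η_mem i)).2
  have h2 := mul_le_mul_of_nonneg_right hB.sumB_le (h1 1 right_mem_I).1
  by_cases ha : B.a0 = 0
  · have h3 := mul_le_mul_of_nonneg_right hB.sumA_le hpos.le
    have h4 := mul_lt_mul_of_pos_right (hB.sumB_lt (hB.b0_pos ha)) (h.resolve_left (not_not.2 ha))
    linarith
  · have h3 := mul_lt_mul_of_pos_right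
      (hB.sumA_lt (lt_of_le_of_ne hB.a0_nonneg (Ne.symm ha))) hpos
    linarith

theorem not_isEigen_of_monotone (hcd : 0 < c ^ 2 + d ^ 2) (hB : B.Admissible 1) {w w' : ℝ → ℝ}
    (h0 : ∀ x ∈ I, 0 ≤ w x ∧ w x ≤ w 1) (h1 : ∀ x ∈ I, 0 ≤ w' x ∧ w' x ≤ w' 1) (hpos : 0 < w 1)
    (h : B.a0 ≠ 0 ∨ 0 < w' 1) (hw : ∀ x, HasDerivAt w (w' x) x)
    (hw' : ∀ x, HasDerivAt w' (-lam * w x) x) {k : ℝ} (hk : k ≠ 0) (hw0 : w (-1) = k * d)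
    (hw0' : w' (-1) = k * c) : ¬IsEigen c d B lam u := by
  intro he
  obtain ⟨C, hC⟩ := exists_eq_const_mul hcd he.contDiffOn he.ode he.left hw hw' hk hw0 hw0'
  have hC0 : C ≠ 0 := by
    rintro rfl
    obtain ⟨x, hx, hx0⟩ := he.nontrivial
    exact hx0 (by simpa using (hC x hx).1)
  apply not_holds_of_monotone hB h0 h1 hpos h
  have hr := he.right
  have e1 : ∀ i, u (B.η i) = C * w (B.η i) := fun i => (hC _ (hB.η_mem i)).1
  have e2 : ∀ i, D u (B.η i) = C * w' (B.η i) := fun i => (hC _ (hB.η_mem i)).2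
  rw [BoundaryData.Holds, (hC 1 right_mem_I).1, (hC 1 right_mem_I).2] at hr
  simp only [e1, e2, mul_left_comm _ C, ← Finset.mul_sum, ← mul_add] at hr
  exact mul_left_cancel₀ hC0 hr

/-- For `lam ≤ 0` the left condition selects a nonnegative combination of `cosh` and `sinh`, or an
affine function. It and its derivative are largest at `1`, so the single-point side wins; only a
constant solution with `a0 = 0` escapes. -/
theorem isEigen_nonneg (hc : 0 ≤ c) (hd : 0 ≤ d) (hcd : 0 < c + d) (hB : B.Admissible 1)
    (h : IsEigen c d B lam u) : 0 ≤ lam ∧ (lam = 0 → c = 0 ∧ B.a0 = 0) := by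
  have hcd2 : 0 < c ^ 2 + d ^ 2 := by
    rcases hc.lt_or_eq with h' | h'
    · positivity
    · have : 0 < d := by linarith
      positivity
  constructor
  · by_contra! hneg
    set s := √(-lam) with hs
    have hspos : 0 < s := sqrt_pos.2 (by linarith)
    have hs2 : s ^ 2 = -lam := sq_sqrt (by linarith)
    have hd1 : ∀ x : ℝ, HasDerivAt (fun x : ℝ => s * (x + 1)) s x := fun x => by
      simpa using ((hasDerivAt_id x).add_const (1 : ℝ)).const_mul s
    have hder : ∀ x, HasDerivAt (fun x => s * d * cosh (s * (x + 1)) + c * sinh (s * (x + 1)))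
        (s * (s * d * sinh (s * (x + 1)) + c * cosh (s * (x + 1)))) x := fun x => by
      exact (((hd1 x).cosh.const_mul (s * d)).fun_add ((hd1 x).sinh.const_mul c)).congr_deriv
        (by ring)
    have hder' : ∀ x, HasDerivAt
        (fun x => s * (s * d * sinh (s * (x + 1)) + c * cosh (s * (x + 1))))
        (-lam * (s * d * cosh (s * (x + 1)) + c * sinh (s * (x + 1)))) x := fun x => by
      exact ((((hd1 x).sinh.const_mul (s * d)).fun_add
        ((hd1 x).cosh.const_mul c)).const_mul s).congr_deriv (by rw [← hs2]; ring)
    have hrange : ∀ x ∈ I, 0 ≤ s * (x + 1) ∧ s * (x + 1) ≤ s * (1 + 1) := fun x hx =>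
      ⟨mul_nonneg hspos.le (by linarith [hx.1]),
        mul_le_mul_of_nonneg_left (by linarith [hx.2]) hspos.le⟩
    have hsd : 0 ≤ s * d := mul_nonneg hspos.le hd
    have hcosh : ∀ x ∈ I, cosh (s * (x + 1)) ≤ cosh (s * (1 + 1)) := fun x hx => by
      rw [cosh_le_cosh, abs_of_nonneg (hrange x hx).1, abs_of_nonneg (by positivity)]
      exact (hrange x hx).2
    have hsinh : ∀ x ∈ I, 0 ≤ sinh (s * (x + 1)) ∧ sinh (s * (x + 1)) ≤ sinh (s * (1 + 1)) :=
      fun x hx => ⟨sinh_nonneg_iff.2 (hrange x hx).1, sinh_le_sinh.2 (hrange x hx).2⟩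
    have hsinh1 : 0 < sinh (s * (1 + 1)) := sinh_pos_iff.2 (by positivity)
    have hcosh1 := cosh_pos (s * (1 + 1))
    refine not_isEigen_of_monotone hcd2 hB (fun x hx => ⟨?_, ?_⟩) (fun x hx => ⟨?_, ?_⟩) ?_
      (Or.inr ?_) hder hder' hspos.ne' ?_ ?_ h
    · exact add_nonneg (mul_nonneg hsd (cosh_pos _).le) (mul_nonneg hc (hsinh x hx).1)
    · exact add_le_add (mul_le_mul_of_nonneg_left (hcosh x hx) hsd)
        (mul_le_mul_of_nonneg_left (hsinh x hx).2 hc)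
    · exact mul_nonneg hspos.le
        (add_nonneg (mul_nonneg hsd (hsinh x hx).1) (mul_nonneg hc (cosh_pos _).le))
    · exact mul_le_mul_of_nonneg_left (add_le_add (mul_le_mul_of_nonneg_left (hsinh x hx).2 hsd)
        (mul_le_mul_of_nonneg_left (hcosh x hx) hc)) hspos.le
    · rcases hc.lt_or_eq with h' | h'
      · positivity
      · have : 0 < d := by linarith
        positivity
    · rcases hc.lt_or_eq with h' | h'
      · positivity
      · have : 0 < d := by linarith
        positivity
    · simp
    · simp
  · rintro rfl
    by_contra hN
    refine not_isEigen_of_monotone (w := fun x => d + c * (x + 1)) (w' := fun _ => c) (k := 1)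
      hcd2 hB (fun x hx => ⟨?_, ?_⟩) (fun x hx => ⟨hc, le_rfl⟩) ?_ ?_ (fun x => ?_) (fun x => ?_)
      one_ne_zero ?_ ?_ h
    · exact add_nonneg hd (mul_nonneg hc (by linarith [hx.1]))
    · have := mul_le_mul_of_nonneg_left (a := c) (b := x + 1) (c := 1 + 1) (by linarith [hx.2]) hc
      linarith
    · linarith
    · by_cases ha : B.a0 = 0
      · exact Or.inr (lt_of_le_of_ne hc fun h' => hN ⟨h'.symm, ha⟩)
      · exact Or.inl ha
    · simpa using (((hasDerivAt_id x).add_const (1 : ℝ)).const_mul c).const_add d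
    · simpa using hasDerivAt_const x c
    · simp
    · simp

theorem charFn_zero_of_neumann (ha : B.a0 = 0) (hB : B.Admissible 1) : charFn 0 d B 0 = 0 := by
  simp [charFn, ha, hB.a_eq_zero ha]

/-- The squares of the roots form the list of eigenvalues. -/
theorem isEigenvalueSequence_sq (hc : 0 ≤ c) (hd : 0 ≤ d) (hcd : 0 < c + d) (hB : B.Admissible 1)
    {r : ℕ → ℝ} (hr : ∀ k, IsRootInWindow c d B k (r k)) :
    IsEigenvalueSequence (fun u => c * u (-1) = d * D u (-1)) (B.Holds 1) fun k => r k ^ 2 := by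
  refine ⟨fun k l hkl => ?_, Set.ext fun lam => ⟨?_, ?_⟩⟩
  · exact pow_lt_pow_left₀ (strictMono_roots hc hd hB hr hkl) (hr k).nonneg two_ne_zero
  · rintro ⟨k, rfl⟩
    refine ⟨_, isEigen_sine hc hd hcd hB (hr k).nonneg ?_ ?_⟩
    · rcases (hr k).root with h | h
      · exact fun h0 => absurd h0 h.1.ne'
      · exact fun _ => h.2.2.1
    · rcases (hr k).root with h | ⟨h, -, rfl, ha⟩
      · exact h.2
      · rw [h]; exact charFn_zero_of_neumann ha hB
  · rintro ⟨u, hu⟩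
    obtain ⟨h0, h00⟩ := isEigen_nonneg hc hd hcd hB hu
    rcases h0.lt_or_eq with h | h
    · have hs : 0 < √lam := sqrt_pos.2 h
      have hs2 : √lam ^ 2 = lam := sq_sqrt h.le
      rw [← hs2] at hu
      obtain ⟨C, hC, hsine⟩ := isEigen_isSineOn hc hd hcd hs.le (fun h => absurd h hs.ne') hu
      obtain ⟨k, hk⟩ := exists_eq_root hc hd hB hr hs ((holds_iff_charFn hB hC hsine).1 hu.right)
      exact ⟨k, by simp only [hk, hs2]⟩
    · obtain ⟨rfl, ha⟩ := h00 h.symm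
      refine ⟨0, ?_⟩
      -- With Neumann type at both ends, window `0` has no positive root, so `r 0` is the eigenvalue
      -- `0`.
      rcases (hr 0).root with h' | h'
      · exact absurd h'.2 (charFn_neg_of_totalPhase_le hd hB ha h'.1 (hr 0).lt_right.le).ne
      · simp only [h'.1, ← h]
        norm_num

end spectrum

/-! ### The Dirichlet and Neumann conditions at `1` -/

/-- The Dirichlet condition at `1`. -/
def dirichletData : BoundaryData := ⟨1, 1, 0, 0, 0, fun _ => -1⟩

/-- The Neumann condition at `1`. -/
def neumannData : BoundaryData := ⟨1, 0, 1, 0, 0, fun _ => -1⟩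

theorem dirichletData_admissible : dirichletData.Admissible 1 := by
  constructor <;> simp [dirichletData]
  norm_num

theorem neumannData_admissible : neumannData.Admissible 1 := by
  constructor <;> simp [neumannData]
  norm_num

theorem dirichletData_holds : dirichletData.Holds 1 = Dirichlet1 := by
  funext u
  simp [BoundaryData.Holds, dirichletData, Dirichlet1]

theorem neumannData_holds : neumannData.Holds 1 = Neumann1 := by
  funext u
  simp [BoundaryData.Holds, neumannData, Neumann1]

section comparison
variable {c d : ℝ} {B : BoundaryData}

theorem charFn_dirichlet (s : ℝ) : charFn c d dirichletData s = sin (phase c d s 1) := by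
  simp [charFn, dirichletData]

theorem charFn_neumann (s : ℝ) : charFn c d neumannData s = s * cos (phase c d s 1) := by
  simp [charFn, neumannData]

theorem totalPhase_dirichlet (s : ℝ) : totalPhase c d dirichletData s = phase c d s 1 := by
  simp [totalPhase, dirichletData, ang]

theorem totalPhase_neumann (s : ℝ) :
    totalPhase c d neumannData s = phase c d s 1 + π / 2 := by
  simp [totalPhase, neumannData, ang]

/-! ### Interlacing with the comparison roots -/

theorem phase_le_totalPhase (hB : B.Admissible 1) {s : ℝ} (hs : 0 ≤ s) :
    phase c d s 1 ≤ totalPhase c d B s :=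
  le_add_of_nonneg_right (ang_nonneg hB.a0_nonneg hB.b0_nonneg hs)

theorem totalPhase_le_phase_add {s : ℝ} : totalPhase c d B s ≤ phase c d s 1 + π / 2 :=
  add_le_add le_rfl (ang_le _ _ _)

theorem phase_of_dirichlet_root {k : ℕ} {z : ℝ} (h : IsRootInWindow c d dirichletData k z) :
    0 < z ∧ phase c d z 1 = (k + 1 : ℕ) * π := by
  have hπ := pi_pos
  have h1 := h.left_lt
  have h2 := h.lt_right
  rw [totalPhase_dirichlet] at h1 h2
  rcases h.root with ⟨hz, h0⟩ | ⟨-, -, -, ha⟩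
  · refine ⟨hz, ?_⟩
    rw [charFn_dirichlet] at h0
    push_cast at h2 ⊢
    have : sin (phase c d z 1 - (k + 1 : ℕ) * π) = 0 := by
      rw [sin_sub_nat_mul_pi, h0, mul_zero]
    have := (sin_eq_zero_iff_of_lt_of_lt (by push_cast; linarith) (by push_cast; linarith)).1 this
    push_cast at this
    linarith
  · simp [dirichletData] at ha

theorem phase_of_neumann_root {k : ℕ} {z : ℝ} (h : IsRootInWindow c d neumannData k z) :
    phase c d z 1 = π / 2 + k * π := by
  have hπ := pi_pos
  have h1 := h.left_lt
  have h2 := h.lt_right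
  rw [totalPhase_neumann] at h1 h2
  push_cast at h2
  rcases h.root with ⟨hz, h0⟩ | ⟨rfl, rfl, rfl, -⟩
  · rw [charFn_neumann] at h0
    have h0 := (mul_eq_zero.1 h0).resolve_left hz.ne'
    have : sin (phase c d z 1 + π / 2 - (k + 1 : ℕ) * π) = 0 := by
      rw [sin_sub_nat_mul_pi, sin_add_pi_div_two, h0, mul_zero]
    have := (sin_eq_zero_iff_of_lt_of_lt (by push_cast; linarith) (by push_cast; linarith)).1 this
    push_cast at this
    linarith
  · simp [phase, ang_of_zero]

/-- Unconditional, as is `dirichlet_lt_root_succ`: the window bounds `W`, and `W` exceeds the phase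
at `1` by at most `π / 2`. -/
theorem root_lt_neumann_succ (hc : 0 ≤ c) (hd : 0 ≤ d) (hB : B.Admissible 1) {k : ℕ} {z y : ℝ}
    (hz : IsRootInWindow c d B k z) (hy : IsRootInWindow c d neumannData (k + 1) y) : z < y := by
  refine (strictMono_phase_one hc hd).lt_iff_lt.1 ?_
  simp only [phase_of_neumann_root hy]
  exact (phase_le_totalPhase hB hz.nonneg).trans_lt hz.lt_right

theorem dirichlet_lt_root_succ (hc : 0 ≤ c) (hd : 0 ≤ d) {k : ℕ} {z y : ℝ}
    (hz : IsRootInWindow c d B (k + 1) z) (hy : IsRootInWindow c d dirichletData k y) : y < z := by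
  refine (strictMono_phase_one hc hd).lt_iff_lt.1 ?_
  simp only [(phase_of_dirichlet_root hy).2]
  linarith [totalPhase_le_phase_add (c := c) (d := d) (B := B) (s := z), hz.left_lt]

theorem root_pos {k : ℕ} {z : ℝ} (hz : IsRootInWindow c d B k z) (h : 0 < c + B.a0) :
    0 < z ∧ charFn c d B z = 0 :=
  hz.root.resolve_right fun h' => by
    rw [h'.2.2.1, h'.2.2.2] at h
    simp at h

/-- At a Neumann root the cosine at `1` vanishes and only `±a0` remains on the left; `DerivCond`
makes it dominate, so `F` still has its sign from before the root. -/
theorem neumann_lt_root (hc : 0 ≤ c) {k : ℕ} {z y t : ℝ}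
    (hz : IsRootInWindow c d B k z) (hy : IsRootInWindow c d neumannData k y) (hyt : y ≤ t)
    (h : B.DerivCond (t ^ 2)) : y < z := by
  have hy0 := hy.nonneg
  rw [BoundaryData.DerivCond, sqrt_sq (hy0.trans hyt)] at h
  change B.sumA + t * B.sumB < B.a0 at h
  have hy' : B.sumA + y * B.sumB < B.a0 :=
    (add_le_add le_rfl (mul_le_mul_of_nonneg_right hyt B.sumB_nonneg)).trans_lt h
  have ha : 0 < B.a0 :=
    (add_nonneg B.sumA_nonneg (mul_nonneg hy0 B.sumB_nonneg)).trans_lt hy'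
  obtain ⟨hz0, hF⟩ := root_pos hz (by linarith)
  have hsign : 0 < (-1) ^ k * charFn c d B y := by
    have h1 := abs_le.1 (abs_sum_sin_le (B := B) fun i => phase c d y (B.η i))
    have h2 := abs_le.1 (abs_sum_cos_le (B := B) hy0 fun i => phase c d y (B.η i))
    rw [charFn, phase_of_neumann_root hy, sin_add_nat_mul_pi, cos_add_nat_mul_pi, sin_pi_div_two,
      cos_pi_div_two]
    rcases neg_one_pow_eq_or ℝ k with hj | hj <;> rw [hj] <;> linarith
  by_contra! hzy
  rcases hzy.lt_or_eq with hlt | rfl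
  · refine (hz.sign_after y hlt ?_).not_gt hsign
    have := phase_of_neumann_root hy
    push_cast
    linarith [totalPhase_le_phase_add (c := c) (d := d) (B := B) (s := y), pi_pos]
  · simp [hF] at hsign

/-- At a Dirichlet root only `±y * b0` remains on the left; `ValueCond`, which persists for larger
frequencies, gives `F` its sign from after the root. -/
theorem root_lt_dirichlet (hB : B.Admissible 1) {k : ℕ} {z y t : ℝ}
    (hz : IsRootInWindow c d B k z) (hy : IsRootInWindow c d dirichletData k y) (ht : 0 < t)
    (hty : t ≤ y) (h : B.ValueCond (t ^ 2)) : z < y := by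
  obtain ⟨hy0, hph⟩ := phase_of_dirichlet_root hy
  rw [BoundaryData.ValueCond, sqrt_sq ht.le] at h
  change 1 / t * B.sumA + B.sumB < B.b0 at h
  have hy' : B.sumA + y * B.sumB < y * B.b0 := by
    have h1 : 1 / y * B.sumA ≤ 1 / t * B.sumA :=
      mul_le_mul_of_nonneg_right (one_div_le_one_div_of_le ht hty) B.sumA_nonneg
    have h2 := mul_lt_mul_of_pos_left ((add_le_add h1 le_rfl).trans_lt h) hy0
    calc B.sumA + y * B.sumB = y * (1 / y * B.sumA + B.sumB) := by field_simp
      _ < _ := h2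
  have hsign : (-1) ^ k * charFn c d B y < 0 := by
    have h1 := abs_le.1 (abs_sum_sin_le (B := B) fun i => phase c d y (B.η i))
    have h2 := abs_le.1 (abs_sum_cos_le (B := B) hy0.le fun i => phase c d y (B.η i))
    rw [charFn, hph, sin_nat_mul_pi, cos_nat_mul_pi, pow_succ]
    rcases neg_one_pow_eq_or ℝ k with hj | hj <;> rw [hj] <;> linarith
  by_contra! hzy
  rcases hzy.lt_or_eq with hlt | rfl
  · refine (hz.sign_before y hy0 ?_ hlt).not_gt hsign
    have := phase_le_totalPhase (c := c) (d := d) hB hy0.le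
    rw [hph] at this
    push_cast at this
    linarith [pi_pos]
  · rcases hz.root with h' | h'
    · simp [h'.2] at hsign
    · exact hy0.ne' h'.1

end comparison

/-! ### Counting zeros -/

theorem int_mul_pi_lt_iff {y : ℝ} {m n : ℤ} (h1 : m * π < y) (h2 : y ≤ (m + 1) * π) :
    n * π < y ↔ n ≤ m := by
  constructor
  · intro h
    have : (n : ℝ) < (m + 1 : ℤ) := by
      push_cast
      exact lt_of_mul_lt_mul_right (h.trans_le h2) pi_pos.le
    exact Int.lt_add_one_iff.1 (by exact_mod_cast this)
  · intro h
    have : (n : ℝ) ≤ m := by exact_mod_cast h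
    exact (mul_le_mul_of_nonneg_right this pi_pos.le).trans_lt h1

theorem encard_sin_zeros {s ψ : ℝ} (hs : s ≠ 0) {J : Set ℝ} {k : ℕ}
    (hJ : ∀ x, ∀ n : ℤ, s * (x + 1) + ψ = n * π → (x ∈ J ↔ 1 ≤ n ∧ n ≤ k)) :
    {x ∈ J | sin (s * (x + 1) + ψ) = 0}.encard = k := by
  have hπ := pi_ne_zero
  have himg : {x ∈ J | sin (s * (x + 1) + ψ) = 0} =
      -- The index `j` corresponds to the multiple `n = j + 1`: the multiple `0` is never counted.
      (fun j : ℕ => (((j + 1 : ℕ) : ℝ) * π - ψ) / s - 1) '' (Finset.range k : Set ℕ) := by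
    ext x
    constructor
    · rintro ⟨hx, h0⟩
      obtain ⟨n, hn⟩ := sin_eq_zero_iff.1 h0
      obtain ⟨h1, h2⟩ := (hJ x n hn.symm).1 hx
      refine ⟨(n - 1).toNat, by simp only [Finset.coe_range, mem_Iio]; omega, ?_⟩
      have : (((n - 1).toNat + 1 : ℕ) : ℝ) = n := by
        have : (((n - 1).toNat + 1 : ℕ) : ℤ) = n := by omega
        exact_mod_cast this
      simp only [this, hn]
      field_simp
      ring
    · rintro ⟨j, hj, rfl⟩
      have hj' : j < k := by simpa using hj
      have he : s * ((((j + 1 : ℕ) : ℝ) * π - ψ) / s - 1 + 1) + ψ = ((j + 1 : ℕ) : ℤ) * π := by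
        push_cast
        field_simp
        ring
      refine ⟨(hJ _ _ he).2 ⟨by omega, by omega⟩, ?_⟩
      simp only [he]
      exact sin_int_mul_pi _
  have hinj : Function.Injective fun j : ℕ => (((j + 1 : ℕ) : ℝ) * π - ψ) / s - 1 := by
    intro i j hij
    have h1 : (((i + 1 : ℕ) : ℝ) * π - ψ) / s = (((j + 1 : ℕ) : ℝ) * π - ψ) / s := by
      simpa using hij
    have h2 := (div_left_inj' hs).1 h1
    have h3 : ((i + 1 : ℕ) : ℝ) = ((j + 1 : ℕ) : ℝ) := mul_right_cancel₀ hπ (by linarith)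
    have h4 : i + 1 = j + 1 := by exact_mod_cast h3
    omega
  rw [himg, hinj.encard_image, encard_coe_eq_coe_finsetCard, Finset.card_range]

section nodal
variable {c d s C : ℝ} {u : ℝ → ℝ} {k : ℕ}

theorem neg_one_lt_iff (hs : 0 < s) {x : ℝ} : -1 < x ↔ 0 < s * (x + 1) := by
  rw [mul_pos_iff_of_pos_left hs]
  constructor <;> intro h <;> linarith

theorem neg_one_le_iff (hs : 0 < s) {x : ℝ} : -1 ≤ x ↔ 0 ≤ s * (x + 1) := by
  rw [mul_nonneg_iff_of_pos_left hs]
  constructor <;> intro h <;> linarith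

theorem lt_one_iff (hs : 0 < s) {x : ℝ} : x < 1 ↔ s * (x + 1) < s * (1 + 1) := by
  rw [mul_lt_mul_iff_right₀ hs]
  constructor <;> intro h <;> linarith

theorem IsSineOn.neg (h : IsSineOn c d s C u) : IsSineOn c d s (-C) fun x => -u x := by
  have hneg : ∀ f : ℝ → ℝ, D (fun x => -f x) = fun x => -D f x := fun f => by
    funext x
    exact derivWithin.fun_neg
  intro x hx
  obtain ⟨h1, h2, h3⟩ := h x hx
  rw [hneg u, hneg (D u)]
  simp only [h1, h2, h3]
  exact ⟨by ring, by ring, by ring⟩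

theorem simpleZeros_of_isSineOn (hc : 0 ≤ c) (hd : 0 ≤ d) (hC : C ≠ 0) (hs : 0 ≤ s)
    (h : IsSineOn c d s C u) (h1 : k * π < phase c d s 1)
    (h2 : phase c d s 1 < (k + 1 : ℕ) * π) : SimpleZeros u (Ioo (-1) 1) k := by
  have hπ := pi_pos
  push_cast at h2
  have hset : {x ∈ Ioo (-1 : ℝ) 1 | u x = 0} =
      {x ∈ Ioo (-1 : ℝ) 1 | sin (s * (x + 1) + ang c d s) = 0} := by
    ext x
    simp only [mem_ofPred_eq]
    refine and_congr_right fun hx => ?_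
    rw [(h x (Ioo_subset_Icc_self hx)).1, mul_eq_zero, or_iff_right hC, phase]
  rcases hs.lt_or_eq with hs | rfl
  · refine ⟨fun x hx h0 => ?_, ?_⟩
    · obtain ⟨e1, e2, -⟩ := h x (Ioo_subset_Icc_self hx)
      rw [e1, mul_eq_zero, or_iff_right hC] at h0
      rw [e2]
      refine mul_ne_zero hC (mul_ne_zero hs.ne' fun h0' => ?_)
      have := sin_sq_add_cos_sq (phase c d s x)
      simp [h0, h0'] at this
    · rw [hset]
      refine encard_sin_zeros hs.ne' fun x n hn => ?_
      have ha := ang_nonneg hc hd hs.le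
      have ha' := ang_le c d s
      have e1 := int_mul_pi_lt_iff (y := phase c d s 1) (m := k) (n := n)
        (by push_cast; exact h1) (by push_cast; exact h2.le)
      have e2 : 0 < (n : ℝ) ↔ 1 ≤ n := by rw [Int.cast_pos]; rfl
      rw [mem_Ioo, neg_one_lt_iff hs, lt_one_iff hs, ← e1, phase]
      constructor
      · rintro ⟨g1, g2⟩
        exact ⟨e2.1 (pos_of_mul_pos_left (by linarith) hπ.le), by linarith⟩
      · rintro ⟨g1, g2⟩
        have : (1 : ℝ) ≤ n := by exact_mod_cast g1
        have := mul_le_mul_of_nonneg_right this hπ.le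
        exact ⟨by linarith, by linarith⟩
  -- For `s = 0` the function is constant and the phase is at most `π / 2`, so `k = 0`.
  · have ha := ang_le c d 0
    have ha0 := ang_nonneg (c := c) (d := d) hc hd le_rfl
    have hph : ∀ x, phase c d 0 x = ang c d 0 := fun x => by simp [phase]
    rw [hph] at h1 h2
    have hk : k = 0 := by
      by_contra hk
      have : (1 : ℝ) ≤ k := by exact_mod_cast Nat.one_le_iff_ne_zero.2 hk
      nlinarith
    subst hk
    have hu : ∀ x ∈ Ioo (-1 : ℝ) 1, u x ≠ 0 := fun x hx => by
      rw [(h x (Ioo_subset_Icc_self hx)).1, hph]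
      exact mul_ne_zero hC (sin_pos_of_pos_of_lt_pi (by simpa using h1) (by linarith)).ne'
    refine ⟨fun x hx h0 => absurd h0 (hu x hx), ?_⟩
    have : {x ∈ Ioo (-1 : ℝ) 1 | u x = 0} = ∅ := by
      ext x
      simpa using fun h1 h2 => hu x ⟨h1, h2⟩
    rw [this]
    simp

theorem sin_phase_one_ne_zero (h1 : k * π < phase c d s 1)
    (h2 : phase c d s 1 < (k + 1 : ℕ) * π) : sin (phase c d s 1) ≠ 0 := by
  push_cast at h2
  have := sin_pos_of_pos_of_lt_pi (x := phase c d s 1 - k * π) (by linarith) (by linarith)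
  rw [sin_sub_nat_mul_pi] at this
  exact right_ne_zero_of_mul this.ne'

/-- The phase starts in `[0, π / 2]` and meets `π, …, kπ` inside; it starts at `0` exactly in the
Dirichlet case `d = 0`, giving the uncounted zero at `-1`. -/
theorem mem_SRobin {Bm : BoundaryData} (hc : 0 ≤ c) (hd : 0 ≤ d) (hcd : 0 < c + d)
    (hBd : Bm.b0 = -d) (hu : ContDiffOn ℝ 2 u I) (hC : C ≠ 0) (hs : 0 ≤ s)
    (hs0 : s = 0 → c = 0) (h : IsSineOn c d s C u) (h1 : k * π < phase c d s 1)
    (h2 : phase c d s 1 < (k + 1 : ℕ) * π) : u ∈ SRobin Bm k := by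
  have hsin := sin_phase_one_ne_zero h1 h2
  have hu1 : u 1 ≠ 0 := by
    rw [(h 1 right_mem_I).1]
    exact mul_ne_zero hC hsin
  by_cases hd0 : d = 0
  · subst hd0
    have hc0 : c ≠ 0 := by linarith
    have hspos : 0 < s := lt_of_le_of_ne hs fun h' => hc0 (hs0 h'.symm)
    refine Or.inr ⟨by rw [hBd, neg_zero], hu, ?_, ?_, hu1,
      simpleZeros_of_isSineOn hc hd hC hs h h1 h2⟩
    · rw [BoundaryData.Robin, (h _ left_mem_I).1, phase_neg_one, ang_of_right_zero hc0, hBd]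
      simp
    · rw [(h _ left_mem_I).2.1, phase_neg_one, ang_of_right_zero hc0, cos_zero, mul_one]
      exact mul_ne_zero hC hspos.ne'
  · have hd' : 0 < d := lt_of_le_of_ne hd (Ne.symm hd0)
    have hang : 0 < ang c d s := by
      rcases hs.lt_or_eq with h' | h'
      · exact ang_pos hc hd' h'
      · rw [hs0 h'.symm, ang_of_zero]; positivity
    have hsin0 : 0 < sin (ang c d s) :=
      sin_pos_of_pos_of_lt_pi hang (by linarith [ang_le c d s, pi_pos])
    refine Or.inl ⟨by rw [hBd]; exact neg_ne_zero.2 hd0, ?_⟩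
    have hval : u (-1) = C * sin (ang c d s) := by rw [(h _ left_mem_I).1, phase_neg_one]
    rcases lt_or_gt_of_ne hC with hC' | hC'
    · have hpos : 0 < -u (-1) := by
        rw [hval, ← neg_mul]; exact mul_pos (neg_pos.2 hC') hsin0
      exact Or.inr ⟨hu.neg, hpos.ne', neg_ne_zero.2 hu1, hpos,
        simpleZeros_of_isSineOn hc hd (neg_ne_zero.2 hC) hs h.neg h1 h2⟩
    · have hpos : 0 < u (-1) := by rw [hval]; exact mul_pos hC' hsin0
      exact Or.inl ⟨hu, hpos.ne', hu1, hpos, simpleZeros_of_isSineOn hc hd hC hs h h1 h2⟩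

theorem zeroBetween_of_isSineOn (hC : C ≠ 0) (hs : 0 < s) (h : IsSineOn c d s C u) {J : Set ℝ}
    (hJ : J ⊆ I) : ZeroBetween u J := by
  have hπ := pi_pos
  have hcos : ∀ x ∈ J, D u x = 0 → ∃ n : ℤ, phase c d s x = n * π + π / 2 := fun x hx h0 => by
    rw [(h x (hJ hx)).2.1, mul_eq_zero, or_iff_right hC, mul_eq_zero, or_iff_right hs.ne',
      cos_eq_zero_iff] at h0
    obtain ⟨n, hn⟩ := h0
    exact ⟨n, by rw [hn]; ring⟩
  intro x hx y hy hxy hx0 hy0 _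
  obtain ⟨n, hn⟩ := hcos x hx hx0
  obtain ⟨m, hm⟩ := hcos y hy hy0
  have hlt : phase c d s x < phase c d s y := by
    unfold phase
    have := mul_lt_mul_of_pos_left hxy hs
    linarith
  have hnm : n < m := by
    have : (n : ℝ) < m := by
      refine lt_of_mul_lt_mul_right (a := π) ?_ hπ.le
      linarith
    exact_mod_cast this
  have hnm' : ((n : ℝ) + 1) * π ≤ m * π := by
    refine mul_le_mul_of_nonneg_right ?_ hπ.le
    exact_mod_cast hnm
  -- A quarter period after a zero of the cosine the sine vanishes.
  have hz : phase c d s (x + π / 2 / s) = ((n + 1 : ℤ) : ℝ) * π := by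
    have : phase c d s (x + π / 2 / s) = phase c d s x + π / 2 := by
      unfold phase
      field_simp
      ring
    rw [this, hn]
    push_cast
    ring
  have hmem : x + π / 2 / s ∈ Ioo x y := by
    refine ⟨lt_add_of_pos_right _ (by positivity), ?_⟩
    have h1 : s * (x + π / 2 / s + 1) + ang c d s < s * (y + 1) + ang c d s := by
      change phase c d s (x + π / 2 / s) < phase c d s y
      rw [hz, hm]
      push_cast
      linarith
    have := lt_of_mul_lt_mul_left ((add_lt_add_iff_right _).1 h1) hs.le
    linarith
  refine ⟨_, hmem, ?_⟩
  rw [(h _ ⟨(hJ hx).1.trans hmem.1.le, hmem.2.le.trans (hJ hy).2⟩).1, hz, sin_int_mul_pi, mul_zero]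

theorem simpleZeros_D_of_isSineOn (hC : C ≠ 0) (hs : 0 < s) (h : IsSineOn c d s C u) {J : Set ℝ}
    (hJI : J ⊆ I) (hJ : ∀ x, ∀ n : ℤ, s * (x + 1) + (ang c d s + π / 2) = n * π →
      (x ∈ J ↔ 1 ≤ n ∧ n ≤ k)) : SimpleZeros (D u) J k := by
  refine ⟨fun x hx h0 => ?_, ?_⟩
  · obtain ⟨-, e2, e3⟩ := h x (hJI hx)
    rw [e2, mul_eq_zero, or_iff_right hC, mul_eq_zero, or_iff_right hs.ne'] at h0
    rw [e3]
    refine mul_ne_zero (neg_ne_zero.2 (pow_ne_zero 2 hs.ne')) (mul_ne_zero hC fun h0' => ?_)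
    have := sin_sq_add_cos_sq (phase c d s x)
    simp [h0, h0'] at this
  · rw [← encard_sin_zeros hs.ne' hJ]
    congr 1
    ext x
    simp only [mem_ofPred_eq]
    refine and_congr_right fun hx => ?_
    rw [(h x (hJI hx)).2.1, mul_eq_zero, or_iff_right hC, mul_eq_zero, or_iff_right hs.ne',
      ← add_assoc, sin_add_pi_div_two, phase]

/-- The cosine vanishes at the phases `π/2, …, π/2 + kπ`, hence `k + 1` zeros. If `c = 0` the phase
starts at `π / 2`, so the first of them is at `-1` and counts. -/
theorem mem_TRobin {Bm : BoundaryData} (hc : 0 ≤ c) (hd : 0 ≤ d)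
    (hBc : Bm.a0 = c) (hu : ContDiffOn ℝ 2 u I) (hC : C ≠ 0) (hs : 0 < s)
    (h : IsSineOn c d s C u) (h1 : π / 2 + k * π < phase c d s 1)
    (h2 : phase c d s 1 < π / 2 + (k + 1 : ℕ) * π) : u ∈ TRobin Bm (k + 1) := by
  have hπ := pi_pos
  push_cast at h2
  have hcos : cos (phase c d s 1) ≠ 0 := by
    have := sin_pos_of_pos_of_lt_pi (x := phase c d s 1 + π / 2 - (k + 1 : ℕ) * π)
      (by push_cast; linarith) (by push_cast; linarith)
    rw [sin_sub_nat_mul_pi, sin_add_pi_div_two] at this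
    exact right_ne_zero_of_mul this.ne'
  have hu1 : D u 1 ≠ 0 := by
    rw [(h 1 right_mem_I).2.1]
    exact mul_ne_zero hC (mul_ne_zero hs.ne' hcos)
  have hlt : ∀ x, ∀ n : ℤ, s * (x + 1) + (ang c d s + π / 2) = n * π →
      (x < 1 ↔ n ≤ (k + 1 : ℕ)) := fun x n hn => by
    have e1 := int_mul_pi_lt_iff (y := phase c d s 1 + π / 2) (m := (k + 1 : ℕ)) (n := n)
      (by push_cast; linarith) (by push_cast; linarith)
    rw [← e1, lt_one_iff hs, phase]
    constructor <;> intro h <;> linarith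
  have ha := ang_nonneg hc hd hs.le
  have hint : ∀ n : ℤ, 0 < (n : ℝ) * π → 1 ≤ n := fun n hn => by
    have : (0 : ℝ) < n := pos_of_mul_pos_left hn hπ.le
    exact_mod_cast this
  have hint' : ∀ n : ℤ, 1 ≤ n → π ≤ (n : ℝ) * π := fun n hn =>
    le_mul_of_one_le_left hπ.le (by exact_mod_cast hn)
  by_cases hc0 : c = 0
  · subst hc0
    refine Or.inr ⟨hBc, hu, ?_, hu1, simpleZeros_D_of_isSineOn hC hs h Ico_subset_Icc_self ?_,
      zeroBetween_of_isSineOn hC hs h Ico_subset_Icc_self⟩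
    · rw [BoundaryData.Robin, (h _ left_mem_I).2.1, phase_neg_one, ang_of_zero, hBc]
      simp
    · intro x n hn
      rw [mem_Ico, hlt x n hn, neg_one_le_iff hs]
      rw [ang_of_zero] at hn
      refine and_congr_left fun _ => ⟨fun g => hint n (by linarith), fun g => ?_⟩
      linarith [hint' n g]
  · have ha' := ang_lt (d := d) (s := s) hc0
    have hJ : ∀ x, ∀ n : ℤ, s * (x + 1) + (ang c d s + π / 2) = n * π →
        (x ∈ Ioo (-1 : ℝ) 1 ↔ 1 ≤ n ∧ n ≤ (k + 1 : ℕ)) := fun x n hn => by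
      rw [mem_Ioo, hlt x n hn, neg_one_lt_iff hs]
      refine and_congr_left fun _ => ⟨fun g => hint n (by linarith), fun g => ?_⟩
      linarith [hint' n g]
    have hcos0 : 0 < cos (ang c d s) := cos_pos_of_mem_Ioo ⟨by linarith, ha'⟩
    have hval : D u (-1) = C * (s * cos (ang c d s)) := by
      rw [(h _ left_mem_I).2.1, phase_neg_one]
    refine Or.inl ⟨by rwa [hBc], ?_⟩
    rcases lt_or_gt_of_ne hC with hC' | hC'
    · have hDneg : ∀ x, D (fun x => -u x) x = -D u x := fun x => derivWithin.fun_neg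
      have hpos : 0 < D (fun x => -u x) (-1) := by
        rw [hDneg, hval, ← neg_mul]
        exact mul_pos (neg_pos.2 hC') (mul_pos hs hcos0)
      exact Or.inr ⟨hu.neg, hpos.ne', by rw [hDneg]; exact neg_ne_zero.2 hu1, hpos,
        simpleZeros_D_of_isSineOn (neg_ne_zero.2 hC) hs h.neg Ioo_subset_Icc_self hJ,
        zeroBetween_of_isSineOn (neg_ne_zero.2 hC) hs h.neg Ioo_subset_Icc_self⟩
    · have hpos : 0 < D u (-1) := by
        rw [hval]
        exact mul_pos hC' (mul_pos hs hcos0)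
      exact Or.inl ⟨hu, hpos.ne', hu1, hpos,
        simpleZeros_D_of_isSineOn hC hs h Ioo_subset_Icc_self hJ,
        zeroBetween_of_isSineOn hC hs h Ioo_subset_Icc_self⟩

end nodal

end MultiPoint

/-! ### Assembly of the theorem -/

theorem mainTheorem4 (Bm Bp : MultiPoint.BoundaryData)
    (hm : Bm.Admissible (-1)) (hp : Bp.Admissible 1)
    (hma : Bm.a = 0) (hmb : Bm.b = 0) :
    ∃ lam lamRN lamRD : ℕ → ℝ,
      MultiPoint.IsEigenvalueSequence (Bm.Holds (-1)) (Bp.Holds 1) lam ∧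
      MultiPoint.IsEigenvalueSequence (Bm.Robin (-1)) MultiPoint.Neumann1 lamRN ∧
      MultiPoint.IsEigenvalueSequence (Bm.Robin (-1)) MultiPoint.Dirichlet1 lamRD ∧
      (∀ k₀ : ℕ, Bp.DerivCond (lamRN k₀) → ∀ k : ℕ, k + 1 ≤ k₀ →
        (∀ ψ, MultiPoint.IsEigenfunction (Bm.Holds (-1)) (Bp.Holds 1) (lam k) ψ →
          ψ ∈ MultiPoint.TRobin Bm (k + 1)) ∧
        lamRN k < lam k ∧ lam k < lamRN (k + 1)) ∧
      (∀ k₀ : ℕ, Bp.ValueCond (lamRD k₀) → ∀ k : ℕ, k₀ + 1 ≤ k →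
        (∀ ψ, MultiPoint.IsEigenfunction (Bm.Holds (-1)) (Bp.Holds 1) (lam k) ψ →
          ψ ∈ MultiPoint.SRobin Bm k) ∧
        lamRD (k - 1) < lam k ∧ lam k < lamRD k) ∧
      (Bp.ValueCond (lamRD 0) →
        (∀ k : ℕ, ∀ ψ, MultiPoint.IsEigenfunction (Bm.Holds (-1)) (Bp.Holds 1) (lam k) ψ →
          ψ ∈ MultiPoint.SRobin Bm k) ∧
        0 ≤ lam 0 ∧ (0 < Bm.a0 + Bp.a0 → 0 < lam 0) ∧ lam 0 < lamRD 0) := by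
  have hRobin : Bm.Robin (-1) = fun u => Bm.a0 * u (-1) = -Bm.b0 * MultiPoint.D u (-1) := by
    funext u
    rw [MultiPoint.BoundaryData.Robin, neg_mul, eq_neg_iff_add_eq_zero]
  have hHolds : Bm.Holds (-1) = Bm.Robin (-1) := by
    funext u
    simp [MultiPoint.BoundaryData.Holds, MultiPoint.BoundaryData.Robin, hma, hmb]
  have hc : 0 ≤ Bm.a0 := hm.a0_nonneg
  have hd : 0 ≤ -Bm.b0 := by simpa using hm.b0_sign
  have hcd : 0 < Bm.a0 + -Bm.b0 := by
    have := hm.nontrivial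
    rwa [abs_of_nonpos (by linarith)] at this
  rw [hHolds, hRobin, ← MultiPoint.neumannData_holds, ← MultiPoint.dirichletData_holds]
  choose r hr using MultiPoint.exists_root hc hd hp
  choose rN hrN using MultiPoint.exists_root hc hd MultiPoint.neumannData_admissible
  choose rD hrD using MultiPoint.exists_root hc hd MultiPoint.dirichletData_admissible
  have hphase := MultiPoint.strictMono_phase_one hc hd
  have hNmono := MultiPoint.strictMono_roots hc hd MultiPoint.neumannData_admissible hrN
  have hDmono := MultiPoint.strictMono_roots hc hd MultiPoint.dirichletData_admissible hrD
  have hsq : ∀ {x y : ℝ}, 0 ≤ x → x < y → x ^ 2 < y ^ 2 := fun hx hxy =>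
    pow_lt_pow_left₀ hxy hx two_ne_zero
  have hr0 : ∀ k, r k = 0 → Bm.a0 = 0 := fun k h => by
    rcases (hr k).root with h' | h'
    · exact absurd h h'.1.ne'
    · exact h'.2.2.1
  -- The lower bound `kπ` on the phase at `1` is automatic from the window; the comparison with `rD
  -- k` supplies the upper bound `(k + 1)π`.
  have hSR : ∀ k, r k < rD k → ∀ ψ, MultiPoint.IsEigen Bm.a0 (-Bm.b0) Bp (r k ^ 2) ψ →
      ψ ∈ MultiPoint.SRobin Bm k := fun k hk ψ hψ => by
    obtain ⟨C, hC, hsine⟩ := MultiPoint.isEigen_isSineOn hc hd hcd (hr k).nonneg (hr0 k) hψ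
    refine MultiPoint.mem_SRobin hc hd hcd (neg_neg _).symm hψ.contDiffOn hC (hr k).nonneg (hr0 k)
      hsine ?_ ?_
    · linarith [(hr k).left_lt, MultiPoint.totalPhase_le_phase_add (c := Bm.a0) (d := -Bm.b0)
        (B := Bp) (s := r k)]
    · rw [← (MultiPoint.phase_of_dirichlet_root (hrD k)).2]
      exact hphase hk
  -- Here the upper bound is automatic, and `rN k` supplies the lower one as well as `r k > 0`.
  have hTR : ∀ k, rN k < r k → ∀ ψ, MultiPoint.IsEigen Bm.a0 (-Bm.b0) Bp (r k ^ 2) ψ →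
      ψ ∈ MultiPoint.TRobin Bm (k + 1) := fun k hk ψ hψ => by
    obtain ⟨C, hC, hsine⟩ := MultiPoint.isEigen_isSineOn hc hd hcd (hr k).nonneg (hr0 k) hψ
    refine MultiPoint.mem_TRobin hc hd rfl hψ.contDiffOn hC ((hrN k).nonneg.trans_lt hk) hsine
      ?_ ((MultiPoint.phase_le_totalPhase hp (hr k).nonneg).trans_lt (hr k).lt_right)
    rw [← MultiPoint.phase_of_neumann_root (hrN k)]
    exact hphase hk
  have hrDpos : ∀ k, 0 < rD k := fun k => (MultiPoint.phase_of_dirichlet_root (hrD k)).1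
  refine ⟨fun k => r k ^ 2, fun k => rN k ^ 2, fun k => rD k ^ 2,
    MultiPoint.isEigenvalueSequence_sq hc hd hcd hp hr,
    MultiPoint.isEigenvalueSequence_sq hc hd hcd MultiPoint.neumannData_admissible hrN,
    MultiPoint.isEigenvalueSequence_sq hc hd hcd MultiPoint.dirichletData_admissible hrD,
    fun k₀ h k hk => ?_, fun k₀ h k hk => ?_, fun h => ?_⟩
  · have hlt : rN k < r k := MultiPoint.neumann_lt_root hc (hr k) (hrN k)
      (hNmono.monotone (by omega)) h
    exact ⟨hTR k hlt, hsq (hrN k).nonneg hlt,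
      hsq (hr k).nonneg (MultiPoint.root_lt_neumann_succ hc hd hp (hr k) (hrN (k + 1)))⟩
  · have hlt : r k < rD k := MultiPoint.root_lt_dirichlet hp (hr k) (hrD k) (hrDpos k₀)
      (hDmono.monotone (by omega)) h
    obtain ⟨l, rfl⟩ : ∃ l, k = l + 1 := ⟨k - 1, by omega⟩
    exact ⟨hSR _ hlt, hsq (hrD l).nonneg (MultiPoint.dirichlet_lt_root_succ hc hd (hr _) (hrD l)),
      hsq (hr _).nonneg hlt⟩
  · have hlt : ∀ k, r k < rD k := fun k => MultiPoint.root_lt_dirichlet hp (hr k) (hrD k)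
      (hrDpos 0) (hDmono.monotone k.zero_le) h
    exact ⟨fun k => hSR k (hlt k), sq_nonneg _,
      fun hpos => pow_pos (MultiPoint.root_pos (hr 0) hpos).1 2, hsq (hr 0).nonneg (hlt 0)⟩
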